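/- Work with linear functionals on the $*$-algebra $\mathbb{C}[x]$ ($x^*=x$); a state (distribution) is a unital, $*$-compatible, positive definite functional. For a unital functional $\phi$ let $M^\phi(z)=\sum_{n\ge1}\phi[x^n]z^n$, let $\eta^\phi=1-(1+M^\phi)^{-1}$ be its Boolean cumulant series, and let $R^\phi$ be its free cumulant series, defined by $M^\phi(w)=R^\phi\bigl((1+M^\phi(w))w\bigr)$. Unital functionals are determined by $R$, and also by $\eta$; $\boxplus$ and $\uplus$ denote the operations which add $R$, respectively $\eta$, and $\phi^{\boxplus t}$, $\phi^{\uplus t}$ are given by $tR^\phi$, $t\eta^\phi$. A state $\rho$ is freely infinitely divisible if $\rho^{\boxplus t}$ is a state for every $t\ge0$. The functional $\Phi[\rho,\psi]$ is defined by $\eta^{\Phi[\rho,\psi]}(w)=(1+M^\psi(w))^{-1}R^\rho\bigl((1+M^\psi(w))w\bigr)$. For $b\in\mathbb{R}$ and $1+c\ge0$, the normalized free Meixner distribution $\mu_{b,c}$ is the state with Jacobi parameters $(0,b,b,\dots)$, $(1,1+c,1+c,\dots)$; the un-normalized free Meixner distributions, of mean $a\in\mathbb{R}$ and variance $v>0$,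 are $\mu_{b,c}^{\uplus v}\uplus\delta_a$. **Proposition.** Let $\rho,\psi$ be freely infinitely divisible states on $\mathbb{C}[x]$, and suppose that $\phi=\Phi[\rho,\psi]$ is an un-normalized free Meixner distribution. Then all the functionals $\phi(t)=\Phi[\rho^{\boxplus t},\psi^{\boxplus t}]$, $t>0$, are un-normalized free Meixner distributions if and only if $\rho$ is an un-normalized free Meixner distribution and $\psi=\rho^{\boxplus(1+s)}\boxplus\delta_\alpha$ for some real $s\ge-1$ and $\alpha\in\mathbb{R}$. If moreover $\phi$ is a normalized free Meixner distribution, the same equivalence holds with "$\rho$ is a normalized free Meixner distribution" on the right-hand side. The Boolean evolution ($\psi=\delta_0$) and the free evolution ($\psi=\rho$) preserve the free Meixner class: if $\rho$ is freely infinitely divisible, $\psi$ is one of these two, and $\Phi[\rho,\psi]$ is un-normalized free Meixner, then so is $\Phi[\rho^{\boxplus t},\psi^{\boxplus t}]$ for every $t>0$. The general c-free evolution does not: there are freely infinitely divisible $\rho,\psi$ such that $\Phi[\rho,\psi]$ is a normalized free Meixner distribution, while $\Phi[\rho^{\boxplus t},\psi^{\boxplus t}]$ is not un-normalized free Meixner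 for some $t>0$. -/

import Mathlib

namespace CFree

open PowerSeries

noncomputable section

/-- Linear functionals on `ℂ[x]`. -/
abbrev Functional := Polynomial ℂ →ₗ[ℂ] ℂ

/-- A state on the `*`-algebra `ℂ[x]` (with `x` self-adjoint, so that `p* = p.map conj`): a unital,
`*`-compatible, positive definite functional.  By `*`-compatibility `φ (p* p)` is real. -/
structure IsState (φ : Functional) : Prop where
  map_one : φ 1 = 1
  map_star : ∀ p : Polynomial ℂ, φ (p.map (starRingEnd ℂ)) = starRingEnd ℂ (φ p)
  nonneg : ∀ p : Polynomial ℂ, 0 ≤ (φ (p.map (starRingEnd ℂ) * p)).re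

/-- The point mass `δ_a[p] = p(a)`. -/
def dirac (a : ℝ) : Functional := Polynomial.leval (a : ℂ)

/-! ### Moments -/

/-- The moment generating function `M^φ(z) = ∑_{n ≥ 1} φ[xⁿ] zⁿ`. -/
def momentSeries (φ : Functional) : ℂ⟦X⟧ :=
  PowerSeries.mk fun n => if n = 0 then 0 else φ (Polynomial.X ^ n)

/-- The unital functional whose `n`-th moment, `n ≥ 1`, is the `n`-th coefficient of `M`. -/
def ofMomentSeries (M : ℂ⟦X⟧) : Functional :=
  (Polynomial.basisMonomials ℂ).constr ℂ fun n => if n = 0 then 1 else coeff n M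

theorem constantCoeff_momentSeries (φ : Functional) : constantCoeff (momentSeries φ) = 0 := by
  simp [momentSeries, ← coeff_zero_eq_constantCoeff_apply]

theorem ofMomentSeries_X_pow (M : ℂ⟦X⟧) (n : ℕ) :
    ofMomentSeries M (Polynomial.X ^ n) = if n = 0 then 1 else coeff n M := by
  have h := (Polynomial.basisMonomials ℂ).constr_basis ℂ
    (fun n => if n = 0 then (1 : ℂ) else coeff n M) n
  simp only [Polynomial.coe_basisMonomials, Polynomial.monomial_one_right_eq_X_pow] at h
  exact h

theorem ofMomentSeries_one (M : ℂ⟦X⟧) : ofMomentSeries M 1 = 1 := by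
  simpa using ofMomentSeries_X_pow M 0

theorem momentSeries_ofMomentSeries {M : ℂ⟦X⟧} (hM : constantCoeff M = 0) :
    momentSeries (ofMomentSeries M) = M := by
  ext n
  rcases Nat.eq_zero_or_pos n with rfl | hn
  · simp [momentSeries, hM]
  · simp [momentSeries, ofMomentSeries_X_pow, hn.ne']

theorem ofMomentSeries_momentSeries {φ : Functional} (hφ : φ 1 = 1) :
    ofMomentSeries (momentSeries φ) = φ := by
  refine (Polynomial.basisMonomials ℂ).ext fun n => ?_
  simp only [Polynomial.coe_basisMonomials, Polynomial.monomial_one_right_eq_X_pow,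
    ofMomentSeries_X_pow]
  rcases Nat.eq_zero_or_pos n with rfl | hn
  · simp [hφ]
  · simp [momentSeries, hn.ne']

/-! ### Boolean cumulants -/

/-- The Boolean cumulant generating function `η^φ = 1 - (1 + M^φ)⁻¹`. -/
def booleanCumulantSeries (φ : Functional) : ℂ⟦X⟧ := 1 - (1 + momentSeries φ)⁻¹

/-- The unital functional with Boolean cumulant generating function `H` (where `H(0) = 0`). -/
def ofBooleanCumulantSeries (H : ℂ⟦X⟧) : Functional := ofMomentSeries ((1 - H)⁻¹ - 1)

theorem booleanCumulantSeries_ofBooleanCumulantSeries {H : ℂ⟦X⟧} (hH : constantCoeff H = 0) :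
    booleanCumulantSeries (ofBooleanCumulantSeries H) = H := by
  have h0 : constantCoeff (1 - H) ≠ 0 := by simp [hH]
  have h1 : constantCoeff ((1 - H)⁻¹) ≠ 0 := by simp [hH]
  have h2 : constantCoeff ((1 - H)⁻¹ - 1) = 0 := by simp [hH]
  rw [booleanCumulantSeries, ofBooleanCumulantSeries, momentSeries_ofMomentSeries h2,
    add_sub_cancel, (PowerSeries.inv_eq_iff_mul_eq_one h1).2 (PowerSeries.mul_inv_cancel _ h0)]
  ring

theorem ofBooleanCumulantSeries_booleanCumulantSeries {φ : Functional} (hφ : φ 1 = 1) :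
    ofBooleanCumulantSeries (booleanCumulantSeries φ) = φ := by
  have h0 : constantCoeff (1 + momentSeries φ) ≠ 0 := by simp [constantCoeff_momentSeries]
  have h1 : constantCoeff ((1 + momentSeries φ)⁻¹) ≠ 0 := by simp [constantCoeff_momentSeries]
  rw [ofBooleanCumulantSeries, booleanCumulantSeries, sub_sub_cancel,
    (PowerSeries.inv_eq_iff_mul_eq_one h1).2 (PowerSeries.mul_inv_cancel _ h0),
    add_sub_cancel_left, ofMomentSeries_momentSeries hφ]

/-! ### Free cumulants -/

open Classical in
/-- The inverse under composition of a series `u X + O(X²)`, `u ≠ 0` (and `0` otherwise). -/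
def compInv (P : ℂ⟦X⟧) : ℂ⟦X⟧ :=
  if h : IsUnit (coeff 1 P) then P.substInvOfIsUnit h else 0

/-- The free cumulant generating function `R^φ`: the solution of `M^φ(w) = R^φ((1 + M^φ(w)) w)`. -/
def freeCumulantSeries (φ : Functional) : ℂ⟦X⟧ :=
  (momentSeries φ).subst (compInv (X * (1 + momentSeries φ)))

/-- The unital functional with free cumulant generating function `R` (where `R(0) = 0`): its moment
generating function is `R(z(w))`, where `z(w)` is the inverse of `w = z / (1 + R(z))`. -/
def ofFreeCumulantSeries (R : ℂ⟦X⟧) : Functional :=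
  ofMomentSeries (R.subst (compInv (X * (1 + R)⁻¹)))

theorem hasSubst_compInv (P : ℂ⟦X⟧) : HasSubst (compInv P) := by
  unfold compInv
  split_ifs with h
  · exact HasSubst.substInvOfIsUnit P h
  · exact HasSubst.zero'

theorem constantCoeff_compInv (P : ℂ⟦X⟧) : constantCoeff (compInv P) = 0 := by
  unfold compInv
  split_ifs with h <;> simp

theorem subst_compInv {Q : ℂ⟦X⟧} (hQ : constantCoeff Q ≠ 0) :
    (X * Q).subst (compInv (X * Q)) = X := by
  have h : IsUnit (coeff 1 (X * Q)) := by
    rw [show (1 : ℕ) = 0 + 1 from rfl, coeff_succ_X_mul]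
    simpa using hQ
  rw [compInv, dif_pos h]
  exact subst_substInvOfIsUnit_right _ (by simp) h

theorem compInv_subst {Q : ℂ⟦X⟧} (hQ : constantCoeff Q ≠ 0) :
    (compInv (X * Q)).subst (X * Q) = X := by
  have h : IsUnit (coeff 1 (X * Q)) := by
    rw [show (1 : ℕ) = 0 + 1 from rfl, coeff_succ_X_mul]
    simpa using hQ
  rw [compInv, dif_pos h]
  exact subst_substInvOfIsUnit_left _ (by simp) h

theorem freeCumulantSeries_spec (φ : Functional) :
    (freeCumulantSeries φ).subst (X * (1 + momentSeries φ)) = momentSeries φ := by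
  have h0 : constantCoeff (1 + momentSeries φ) ≠ 0 := by simp [constantCoeff_momentSeries]
  rw [freeCumulantSeries, subst_comp_subst_apply (hasSubst_compInv _)
    (HasSubst.of_constantCoeff_zero' (by simp)), compInv_subst h0, X_subst]

theorem constantCoeff_freeCumulantSeries (φ : Functional) :
    constantCoeff (freeCumulantSeries φ) = 0 :=
  constantCoeff_subst_eq_zero (constantCoeff_compInv _) _ (constantCoeff_momentSeries φ)

/-- The free cumulant generating function is the only solution of its implicit equation. -/
theorem freeCumulantSeries_unique {φ : Functional} {R : ℂ⟦X⟧}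
    (h : R.subst (X * (1 + momentSeries φ)) = momentSeries φ) : R = freeCumulantSeries φ := by
  have h0 : constantCoeff (1 + momentSeries φ) ≠ 0 := by simp [constantCoeff_momentSeries]
  have e : PowerSeries.subst (compInv (X * (1 + momentSeries φ)))
      (PowerSeries.subst (X * (1 + momentSeries φ)) R : ℂ⟦X⟧) = R := by
    rw [subst_comp_subst_apply (HasSubst.of_constantCoeff_zero' (by simp)) (hasSubst_compInv _),
      subst_compInv h0, X_subst]
  rw [h] at e
  exact e.symm

theorem ofFreeCumulantSeries_equation {R : ℂ⟦X⟧} (hR : constantCoeff R = 0) :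
    momentSeries (ofFreeCumulantSeries R) =
      R.subst (X * (1 + momentSeries (ofFreeCumulantSeries R))) := by
  have hR0 : constantCoeff (1 + R) ≠ 0 := by simp [hR]
  have hR1 : constantCoeff ((1 + R)⁻¹) ≠ 0 := by simp [hR]
  have hz : HasSubst (compInv (X * (1 + R)⁻¹)) := hasSubst_compInv _
  have hM : constantCoeff (R.subst (compInv (X * (1 + R)⁻¹)) : ℂ⟦X⟧) = 0 :=
    constantCoeff_subst_eq_zero (constantCoeff_compInv _) _ hR
  have e1 := subst_compInv hR1
  have e2 : (1 + R).subst (compInv (X * (1 + R)⁻¹)) *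
      ((1 + R)⁻¹).subst (compInv (X * (1 + R)⁻¹)) = (1 : ℂ⟦X⟧) := by
    rw [← subst_mul hz, PowerSeries.mul_inv_cancel _ hR0, ← coe_substAlgHom hz, map_one]
  have e3 : (1 + R).subst (compInv (X * (1 + R)⁻¹)) =
      1 + (R.subst (compInv (X * (1 + R)⁻¹)) : ℂ⟦X⟧) := by
    rw [← coe_substAlgHom hz, map_add, map_one]
  rw [subst_mul hz, subst_X hz] at e1
  rw [e3] at e2
  have e4 : X * (1 + (R.subst (compInv (X * (1 + R)⁻¹)) : ℂ⟦X⟧)) = compInv (X * (1 + R)⁻¹) := by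
    calc _ = compInv (X * (1 + R)⁻¹) * (((1 + R)⁻¹).subst (compInv (X * (1 + R)⁻¹))) *
          (1 + (R.subst (compInv (X * (1 + R)⁻¹)) : ℂ⟦X⟧)) := by rw [e1]
      _ = compInv (X * (1 + R)⁻¹) * ((1 + (R.subst (compInv (X * (1 + R)⁻¹)) : ℂ⟦X⟧)) *
          (((1 + R)⁻¹).subst (compInv (X * (1 + R)⁻¹)))) := by ring
      _ = _ := by rw [e2, mul_one]
  rw [ofFreeCumulantSeries, momentSeries_ofMomentSeries hM, e4]

theorem freeCumulantSeries_ofFreeCumulantSeries {R : ℂ⟦X⟧} (hR : constantCoeff R = 0) :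
    freeCumulantSeries (ofFreeCumulantSeries R) = R :=
  (freeCumulantSeries_unique (ofFreeCumulantSeries_equation hR).symm).symm

/-! ### Convolutions -/

/-- The free convolution `φ ⊞ ψ`: `R^{φ ⊞ ψ} = R^φ + R^ψ`. -/
def freeConv (φ ψ : Functional) : Functional :=
  ofFreeCumulantSeries (freeCumulantSeries φ + freeCumulantSeries ψ)

/-- The free convolution power `φ^{⊞ t}`: its free cumulant generating function is `t R^φ`. -/
def freePow (φ : Functional) (t : ℝ) : Functional :=
  ofFreeCumulantSeries ((t : ℂ) • freeCumulantSeries φ)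

/-- The Boolean convolution `φ ⊎ ψ`: `η^{φ ⊎ ψ} = η^φ + η^ψ`. -/
def booleanConv (φ ψ : Functional) : Functional :=
  ofBooleanCumulantSeries (booleanCumulantSeries φ + booleanCumulantSeries ψ)

/-- The Boolean convolution power `φ^{⊎ t}`: its Boolean cumulant generating function is `t η^φ`. -/
def booleanPow (φ : Functional) (t : ℝ) : Functional :=
  ofBooleanCumulantSeries ((t : ℂ) • booleanCumulantSeries φ)

/-- `ρ` is freely infinitely divisible: it is a state and all `ρ^{⊞ t}`, `t ≥ 0`, are states. -/
def IsFreelyInfinitelyDivisible (ρ : Functional) : Prop :=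
  IsState ρ ∧ ∀ t : ℝ, 0 ≤ t → IsState (freePow ρ t)

/-- The map `Φ[ρ, ψ]`: the unital functional `φ` with
`η^φ(w) = (1 + M^ψ(w))⁻¹ R^ρ((1 + M^ψ(w)) w)`. -/
def Phi (ρ ψ : Functional) : Functional :=
  ofBooleanCumulantSeries
    ((1 + momentSeries ψ)⁻¹ * (freeCumulantSeries ρ).subst (X * (1 + momentSeries ψ)))

/-! ### Free Meixner distributions -/

/-- The monic polynomials with Jacobi parameters `(β 0, β 1, …)`, `(γ 1, γ 2, …)`:
`P₀ = 1`, `P₁ = x - β 0`, `x Pₙ = Pₙ₊₁ + β n Pₙ + γ n Pₙ₋₁`. -/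
def jacobiPolynomial (β γ : ℕ → ℝ) : ℕ → Polynomial ℂ
  | 0 => 1
  | 1 => Polynomial.X - Polynomial.C (β 0 : ℂ)
  | n + 2 => (Polynomial.X - Polynomial.C (β (n + 1) : ℂ)) * jacobiPolynomial β γ (n + 1)
      - Polynomial.C (γ (n + 1) : ℂ) * jacobiPolynomial β γ n

/-- `φ` has Jacobi parameters `(β 0, β 1, …)`, `(γ 1, γ 2, …)`: the polynomials defined by the
three-term recursion are orthogonal with respect to `φ`. (For a unital `φ`, the case of `P₀` against
`Pₙ` already determines `φ`.) -/
def HasJacobiParameters (φ : Functional) (β γ : ℕ → ℝ) : Prop :=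
  ∀ m n : ℕ, m ≠ n → φ (jacobiPolynomial β γ m * jacobiPolynomial β γ n) = 0

/-- `φ = μ_{b,c}`: the state with Jacobi parameters `(0, b, b, …)`, `(1, 1 + c, 1 + c, …)`. -/
def IsMeixnerLaw (b c : ℝ) (φ : Functional) : Prop :=
  IsState φ ∧
    HasJacobiParameters φ (fun n => if n = 0 then 0 else b) (fun n => if n = 1 then 1 else 1 + c)

/-- (Normalized) free Meixner distributions: `μ_{b,c}` with `b ∈ ℝ`, `1 + c ≥ 0`. They have mean `0`
and variance `1`. -/
def IsNormalizedFreeMeixner (φ : Functional) : Prop :=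
  ∃ b c : ℝ, 0 ≤ 1 + c ∧ IsMeixnerLaw b c φ

/-- Un-normalized free Meixner distributions, of mean `a` and variance `v > 0`:
`μ_{b,c}^{⊎ v} ⊎ δ_a`. -/
def IsFreeMeixner (φ : Functional) : Prop :=
  ∃ (μ : Functional) (v a : ℝ), IsNormalizedFreeMeixner μ ∧ 0 < v ∧
    φ = booleanConv (booleanPow μ v) (dirac a)

end

end CFree

/-
Substituting `u = w (1 + M^ψ(w))` makes the free Meixner condition algebraic: `Φ[ρ, ψ]` is free
Meixner if and only if `R^ρ = z (a + v g)`, where `g` solves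
`(1 + R^ψ) g = z (1 + b g + d g²)` with `v > 0`, `d ≥ 0`. Along the evolution `R^ρ` and `R^ψ` are
multiplied by `t`, while `g = z + O(z²)` does not change. Comparing `t = 1` with `t = 2` eliminates
`R^ψ`: `g` satisfies a quadratic equation of its own and `R^ψ = z (p + σ g)`, so that `R^ψ` is an
affine function of `R^ρ`. The parameter `d` for time `t` is then `γ + t σ`, and letting `t → 0` and
`t → ∞` gives `γ, σ ≥ 0`, which are the free infinite divisibility of `ρ` and `s ≥ -1`.

Positivity comes from operator models: if `R^φ = α z + z² K` with `K` the moment series of a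
positive definite functional, then the fixed point iteration
`D ↦ (1 - α z - z² D K(z D))⁻¹` for `1 + M^φ` preserves positive definiteness, because the moments
of `D K(z D)` are those of a symmetric operator averaged over a parameter with moments `K`.

For the counterexample take `g = z A` with `A = (1 - 4 z²)^{-1/2}` the moment series of the arcsine
distribution, `R^ρ = z² A` and `R^ψ = A - 1`. The relation `A² = 1 + 4 z² A²` gives
`(1 + R^ψ) g = z (1 + 4 g²)`, but `R^ψ` is not an affine function of `R^ρ`.
-/

namespace CFree

open PowerSeries

section Substitution

variable {R : Type*} [CommRing R]

theorem hasSubst_X_mul (D : R⟦X⟧) : HasSubst (X * D) :=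
  HasSubst.of_constantCoeff_zero' (by simp)

theorem C_subst (r : R) (a : R⟦X⟧) : (C r : R⟦X⟧).subst a = (C r : R⟦X⟧) :=
  subst_C r

theorem one_subst (a : R⟦X⟧) : (1 : R⟦X⟧).subst a = (1 : R⟦X⟧) := by
  rw [← map_one C, C_subst]

theorem coeff_mul_subst {a : R⟦X⟧} (ha : constantCoeff a = 0) (b K : R⟦X⟧) (n : ℕ) :
    coeff n (b * K.subst a) =
      ∑ k ∈ Finset.range (n + 1), coeff k K * coeff n (b * a ^ k) := by
  have coeff_subst_eq_sum {m : ℕ} (hm : m ≤ n) :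
      coeff m (K.subst a) = ∑ k ∈ Finset.range (n + 1), coeff k K * coeff m (a ^ k) := by
    rw [coeff_subst' (HasSubst.of_constantCoeff_zero' ha)]
    refine finsum_eq_finsetSum_of_support_subset _ fun k hk => ?_
    by_contra hkn
    have hlt : m < k := by
      simp only [Finset.coe_range, Set.mem_Iio] at hkn
      omega
    refine hk ?_
    change coeff k K • coeff m (a ^ k) = 0
    rw [coeff_of_lt_order _ ((Nat.cast_lt.2 hlt).trans_le
      (le_order_pow_of_constantCoeff_eq_zero k ha)), smul_zero]
  simp only [coeff_mul, Finset.mul_sum]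
  rw [Finset.sum_comm]
  refine Finset.sum_congr rfl fun p hp => ?_
  have hpn : p.2 ≤ n :=
    le_of_le_of_eq (Nat.le_add_left _ _) (Finset.HasAntidiagonal.mem_antidiagonal.1 hp)
  rw [coeff_subst_eq_sum hpn, Finset.mul_sum]
  exact Finset.sum_congr rfl fun k _ => mul_left_comm _ _ _

theorem X_pow_dvd_mul_subst_sub_mul_subst {n : ℕ} {D E : R⟦X⟧} (h : X ^ n ∣ D - E) (K : R⟦X⟧) :
    X ^ n ∣ D * K.subst (X * D) - E * K.subst (X * E) := by
  refine X_pow_dvd_iff.2 fun m hm => ?_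
  rw [map_sub, coeff_mul_subst (by simp), coeff_mul_subst (by simp), ← Finset.sum_sub_distrib]
  refine Finset.sum_eq_zero fun k _ => ?_
  have hk : X ^ n ∣ D * (X * D) ^ k - E * (X * E) ^ k := by
    convert! (h.trans (sub_dvd_pow_sub_pow D E (k + 1))).mul_left (X ^ k) using 1
    ring
  rw [← mul_sub, ← map_sub, X_pow_dvd_iff.1 hk m hm, mul_zero]

theorem eq_of_forall_X_pow_dvd_sub {D E : R⟦X⟧} (h : ∀ n, X ^ n ∣ D - E) : D = E :=
  sub_eq_zero.1 <| PowerSeries.ext fun n => X_pow_dvd_iff.1 (h (n + 1)) n n.lt_succ_self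

theorem mk_pow_eq (r : R) : mk (r ^ ·) = 1 + X * (C r * mk (r ^ ·)) := by
  ext n
  cases n with
  | zero => simp
  | succ n => simp [coeff_succ_X_mul, coeff_one, pow_succ']

theorem coeff_one_mul (f g : R⟦X⟧) :
    coeff 1 (f * g) = constantCoeff f * coeff 1 g + coeff 1 f * constantCoeff g := by
  simp [coeff_mul, Finset.Nat.antidiagonal_succ]

theorem constantCoeff_map {S : Type*} [CommRing S] (f : R →+* S) (D : R⟦X⟧) :
    constantCoeff (D.map f) = f (constantCoeff D) := by
  rw [← coeff_zero_eq_constantCoeff_apply, coeff_map, coeff_zero_eq_constantCoeff_apply]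

end Substitution

theorem bijective_subst_X_mul {Q : ℂ⟦X⟧} (hQ : constantCoeff Q ≠ 0) :
    Function.Bijective fun f : ℂ⟦X⟧ => f.subst (X * Q) := by
  refine Function.bijective_iff_has_inverse.2
    ⟨fun f : ℂ⟦X⟧ => f.subst (compInv (X * Q)), fun f => ?_, fun f => ?_⟩ <;> dsimp only
  · rw [subst_comp_subst_apply (hasSubst_X_mul Q) (hasSubst_compInv _), subst_compInv hQ, X_subst]
  · rw [subst_comp_subst_apply (hasSubst_compInv _) (hasSubst_X_mul Q), compInv_subst hQ, X_subst]

/-! ### Cumulants -/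

theorem constantCoeff_one_add_momentSeries_ne_zero (φ : Functional) :
    constantCoeff (1 + momentSeries φ) ≠ 0 := by
  simp [constantCoeff_momentSeries]

theorem one_add_momentSeries_ne_zero (φ : Functional) : 1 + momentSeries φ ≠ 0 := fun h =>
  constantCoeff_one_add_momentSeries_ne_zero φ (by rw [h, map_zero])

theorem one_add_momentSeries_eq_mk {φ : Functional} (hφ : φ 1 = 1) :
    1 + momentSeries φ = mk fun n => φ (Polynomial.X ^ n) := by
  ext n
  cases n with
  | zero => simp [momentSeries, hφ]
  | succ n => simp [momentSeries, coeff_one]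

theorem eq_of_momentSeries_eq {φ ψ : Functional} (hφ : φ 1 = 1) (hψ : ψ 1 = 1)
    (h : momentSeries φ = momentSeries ψ) : φ = ψ := by
  rw [← ofMomentSeries_momentSeries hφ, h, ofMomentSeries_momentSeries hψ]

theorem eq_of_booleanCumulantSeries_eq {φ ψ : Functional} (hφ : φ 1 = 1) (hψ : ψ 1 = 1)
    (h : booleanCumulantSeries φ = booleanCumulantSeries ψ) : φ = ψ := by
  rw [← ofBooleanCumulantSeries_booleanCumulantSeries hφ, h,
    ofBooleanCumulantSeries_booleanCumulantSeries hψ]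

theorem eq_of_freeCumulantSeries_eq {φ ψ : Functional} (hφ : φ 1 = 1) (hψ : ψ 1 = 1)
    (h : freeCumulantSeries φ = freeCumulantSeries ψ) : φ = ψ := by
  have one_add_momentSeries_eq (χ : Functional) : 1 + momentSeries χ =
      1 + X * ((1 + momentSeries χ) *
        ((mk fun n => coeff (n + 1) (freeCumulantSeries χ)).subst (X * (1 + momentSeries χ)))) := by
    have hR := eq_X_mul_shift_add_const (freeCumulantSeries χ)
    rw [constantCoeff_freeCumulantSeries, map_zero, add_zero] at hR
    have hU := hasSubst_X_mul (1 + momentSeries χ)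
    conv_lhs => rw [← freeCumulantSeries_spec χ, hR, subst_mul hU, subst_X hU, mul_assoc]
  have hdvd (n : ℕ) : X ^ n ∣ (1 + momentSeries φ) - (1 + momentSeries ψ) := by
    induction n with
    | zero => simp
    | succ n ih =>
      rw [one_add_momentSeries_eq φ, one_add_momentSeries_eq ψ, h, add_sub_add_left_eq_sub,
        ← mul_sub, pow_succ']
      exact mul_dvd_mul_left X (X_pow_dvd_mul_subst_sub_mul_subst ih _)
  exact eq_of_momentSeries_eq hφ hψ (add_left_cancel (eq_of_forall_X_pow_dvd_sub hdvd))

theorem constantCoeff_booleanCumulantSeries (φ : Functional) :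
    constantCoeff (booleanCumulantSeries φ) = 0 := by
  simp [booleanCumulantSeries, constantCoeff_momentSeries]

theorem booleanCumulantSeries_eq_iff {φ : Functional} {H : ℂ⟦X⟧} :
    booleanCumulantSeries φ = H ↔ (1 + momentSeries φ) * (1 - H) = 1 := by
  rw [mul_comm, ← PowerSeries.eq_inv_iff_mul_eq_one
    (constantCoeff_one_add_momentSeries_ne_zero φ), booleanCumulantSeries, sub_eq_iff_eq_add,
    sub_eq_iff_eq_add']

theorem booleanCumulantSeries_booleanConv (φ ψ : Functional) :
    booleanCumulantSeries (booleanConv φ ψ) =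
      booleanCumulantSeries φ + booleanCumulantSeries ψ := by
  rw [booleanConv, booleanCumulantSeries_ofBooleanCumulantSeries]
  simp [constantCoeff_booleanCumulantSeries]

theorem booleanCumulantSeries_booleanPow (φ : Functional) (t : ℝ) :
    booleanCumulantSeries (booleanPow φ t) = C (t : ℂ) * booleanCumulantSeries φ := by
  rw [booleanPow, smul_eq_C_mul, booleanCumulantSeries_ofBooleanCumulantSeries]
  simp [constantCoeff_booleanCumulantSeries]

theorem freeCumulantSeries_freeConv (φ ψ : Functional) :
    freeCumulantSeries (freeConv φ ψ) = freeCumulantSeries φ + freeCumulantSeries ψ := by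
  rw [freeConv, freeCumulantSeries_ofFreeCumulantSeries]
  simp [constantCoeff_freeCumulantSeries]

theorem freeCumulantSeries_freePow (φ : Functional) (t : ℝ) :
    freeCumulantSeries (freePow φ t) = C (t : ℂ) * freeCumulantSeries φ := by
  rw [freePow, smul_eq_C_mul, freeCumulantSeries_ofFreeCumulantSeries]
  simp [constantCoeff_freeCumulantSeries]

theorem booleanCumulantSeries_dirac (a : ℝ) :
    booleanCumulantSeries (dirac a) = C (a : ℂ) * X := by
  have hM : 1 + momentSeries (dirac a) = mk ((a : ℂ) ^ ·) := by
    rw [one_add_momentSeries_eq_mk (by simp [dirac])]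
    simp [dirac]
  rw [booleanCumulantSeries_eq_iff, hM]
  linear_combination mk_pow_eq (a : ℂ)

theorem freeCumulantSeries_dirac (a : ℝ) : freeCumulantSeries (dirac a) = C (a : ℂ) * X := by
  refine (freeCumulantSeries_unique ?_).symm
  rw [subst_mul (hasSubst_X_mul _), subst_X (hasSubst_X_mul _), C_subst]
  linear_combination -booleanCumulantSeries_eq_iff.1 (booleanCumulantSeries_dirac a)

theorem booleanCumulantSeries_Phi (ρ ψ : Functional) :
    (1 + momentSeries ψ) * booleanCumulantSeries (Phi ρ ψ) =
      (freeCumulantSeries ρ).subst (X * (1 + momentSeries ψ)) := by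
  have hR : constantCoeff ((freeCumulantSeries ρ).subst (X * (1 + momentSeries ψ)) : ℂ⟦X⟧) = 0 :=
    constantCoeff_subst_eq_zero (show constantCoeff (X * (1 + momentSeries ψ)) = 0 by simp) _
      (constantCoeff_freeCumulantSeries ρ)
  rw [Phi, booleanCumulantSeries_ofBooleanCumulantSeries (by rw [map_mul, hR, mul_zero]),
    ← mul_assoc, PowerSeries.mul_inv_cancel _ (constantCoeff_one_add_momentSeries_ne_zero ψ),
    one_mul]

theorem booleanConv_one (φ ψ : Functional) : booleanConv φ ψ 1 = 1 := ofMomentSeries_one _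

theorem freeConv_one (φ ψ : Functional) : freeConv φ ψ 1 = 1 := ofMomentSeries_one _

theorem freePow_one (φ : Functional) (t : ℝ) : freePow φ t 1 = 1 := ofMomentSeries_one _

theorem Phi_one (ρ ψ : Functional) : Phi ρ ψ 1 = 1 := ofMomentSeries_one _

theorem Phi_self {ρ : Functional} (hρ : ρ 1 = 1) : Phi ρ ρ = ρ := by
  refine eq_of_booleanCumulantSeries_eq (Phi_one _ _) hρ ?_
  apply mul_left_cancel₀ (one_add_momentSeries_ne_zero ρ)
  rw [booleanCumulantSeries_Phi, freeCumulantSeries_spec]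
  linear_combination booleanCumulantSeries_eq_iff.1 (rfl : _ = booleanCumulantSeries ρ)

/-! ### The quadratic equation of the free Meixner class -/

section MeixnerRoot

variable {k : Type*} [CommRing k] {a v b d β γ p σ t : k} {R S g : k⟦X⟧}

/-- The quadratic equation satisfied by the series `g` that generates, after the change of variable
`u = w (1 + M^ψ(w))`, the Boolean cumulants of a free Meixner distribution `Φ[ρ, ψ]`; here `S`
stands for `R^ψ`. -/
def IsMeixnerRoot (b d : k) (S g : k⟦X⟧) : Prop :=
  (1 + S) * g = X * (1 + C b * g + C d * g ^ 2)

/-- The condition on `R = R^ρ` and `S = R^ψ` under which `Φ[ρ, ψ]` has the Boolean cumulants of a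
free Meixner functional of mean `a` and variance `v`. -/
def IsMeixnerPair (a v b d : k) (R S : k⟦X⟧) : Prop :=
  ∃ g, R = X * (C a + C v * g) ∧ IsMeixnerRoot b d S g

/-- The pairs `(R, S)` for which all multiples `(t R, t S)` are Meixner pairs with one and the same
root `g`, which then does not depend on `S`. -/
def IsAffineMeixnerPair (a v β γ p σ : k) (R S : k⟦X⟧) : Prop :=
  ∃ g, R = X * (C a + C v * g) ∧ S = X * (C p + C σ * g) ∧ IsMeixnerRoot β γ 0 g

theorem isMeixnerRoot_zero_iff :
    IsMeixnerRoot b d 0 g ↔ g = X * (1 + C b * g + C d * g ^ 2) := by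
  rw [IsMeixnerRoot, add_zero, one_mul]

theorem IsMeixnerRoot.constantCoeff_eq_zero (hS : constantCoeff S = 0)
    (h : IsMeixnerRoot b d S g) : constantCoeff g = 0 := by
  simpa [hS] using congrArg constantCoeff h

theorem IsMeixnerRoot.coeff_one_eq_one (hS : constantCoeff S = 0) (h : IsMeixnerRoot b d S g) :
    coeff 1 g = 1 := by
  simpa [coeff_one_mul, hS, h.constantCoeff_eq_zero hS] using congrArg (coeff 1) h

theorem coeffs_eq_of_C_add_C_mul_eq {a' v' : k} {g' : k⟦X⟧} (hg : constantCoeff g = 0)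
    (hg₁ : coeff 1 g = 1) (hg' : constantCoeff g' = 0) (hg₁' : coeff 1 g' = 1)
    (h : C a + C v * g = C a' + C v' * g') : a = a' ∧ v = v' :=
  ⟨by simpa [hg, hg'] using congrArg constantCoeff h,
    by simpa [hg₁, hg₁', coeff_C] using congrArg (coeff 1) h⟩

theorem IsAffineMeixnerPair.isMeixnerPair_mul (h : IsAffineMeixnerPair a v β γ p σ R S) (t : k) :
    IsMeixnerPair (t * a) (t * v) (β + t * p) (γ + t * σ) (C t * R) (C t * S) := by
  obtain ⟨g, rfl, rfl, hg⟩ := h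
  refine ⟨g, ?_, ?_⟩
  · rw [map_mul, map_mul]
    ring
  · rw [isMeixnerRoot_zero_iff] at hg
    simp only [IsMeixnerRoot, map_add, map_mul]
    linear_combination hg

theorem IsAffineMeixnerPair.isMeixnerPair (h : IsAffineMeixnerPair a v β γ p σ R S) :
    IsMeixnerPair a v (β + p) (γ + σ) R S := by
  simpa using h.isMeixnerPair_mul 1

theorem isMeixnerPair_self_iff :
    IsMeixnerPair a v b d R R ↔ IsAffineMeixnerPair a v (b - a) (d - v) a v R R := by
  refine ⟨?_, fun h => by simpa using h.isMeixnerPair⟩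
  rintro ⟨g, rfl, hg⟩
  refine ⟨g, rfl, rfl, ?_⟩
  simp only [IsMeixnerRoot, map_sub] at hg ⊢
  linear_combination hg

theorem isMeixnerPair_zero_iff :
    IsMeixnerPair a v b d R 0 ↔ IsAffineMeixnerPair a v b d 0 0 R 0 := by
  simp [IsMeixnerPair, IsAffineMeixnerPair]

theorem IsAffineMeixnerPair.affine_right {s α : k} (h : IsAffineMeixnerPair a v β γ p σ R S) :
    IsAffineMeixnerPair a v β γ (s * p + α) (s * σ) R (C s * S + C α * X) := by
  obtain ⟨g, hR, rfl, hg⟩ := h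
  refine ⟨g, hR, ?_, hg⟩
  simp only [map_add, map_mul]
  ring

section Domain

variable [IsDomain k]

theorem IsMeixnerRoot.ne_zero (hS : constantCoeff S = 0) (h : IsMeixnerRoot b d S g) : g ≠ 0 := by
  rintro rfl
  simpa using h.coeff_one_eq_one hS

theorem IsMeixnerRoot.eq_X_mul (h₀ : IsMeixnerRoot β γ 0 g) (h : IsMeixnerRoot b d S g) :
    S = X * (C (b - β) + C (d - γ) * g) := by
  apply mul_right_cancel₀ (h₀.ne_zero (map_zero _))
  simp only [IsMeixnerRoot, map_sub] at h h₀ ⊢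
  linear_combination h - h₀

theorem IsMeixnerPair.isMeixnerRoot_of_mul {a' v' b' d' : k} (hS : constantCoeff S = 0)
    (hR : R = X * (C a + C v * g)) (hg : IsMeixnerRoot b d S g) (hv' : v' ≠ 0)
    (h : IsMeixnerPair a' v' b' d' (C t * R) (C t * S)) : IsMeixnerRoot b' d' (C t * S) g := by
  obtain ⟨g', hR', hg'⟩ := h
  have hS' : constantCoeff (C t * S) = 0 := by simp [hS]
  have heq : C (t * a) + C (t * v) * g = C a' + C v' * g' := by
    apply mul_left_cancel₀ (X_ne_zero (R := k))
    rw [← hR', hR, map_mul, map_mul]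
    ring
  obtain ⟨ha, hv⟩ := coeffs_eq_of_C_add_C_mul_eq (hg.constantCoeff_eq_zero hS)
    (hg.coeff_one_eq_one hS) (hg'.constantCoeff_eq_zero hS') (hg'.coeff_one_eq_one hS') heq
  rw [ha, hv] at heq
  have hgg' : g = g' :=
    mul_left_cancel₀ ((map_ne_zero_iff C C_injective).2 hv') (add_left_cancel heq)
  exact hgg' ▸ hg'

/-- A root `g` common to `S` and `2 S` satisfies a quadratic equation free of `S`, so that `S` is an
affine function of `g`. -/
theorem IsMeixnerPair.isAffineMeixnerPair_of_two {a₂ v₂ b₂ d₂ : k} (hS : constantCoeff S = 0)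
    (h : IsMeixnerPair a v b d R S) (hv₂ : v₂ ≠ 0)
    (h₂ : IsMeixnerPair a₂ v₂ b₂ d₂ (C 2 * R) (C 2 * S)) :
    IsAffineMeixnerPair a v (2 * b - b₂) (2 * d - d₂) (b₂ - b) (d₂ - d) R S := by
  obtain ⟨g, hR, hg⟩ := h
  have hg₂ := h₂.isMeixnerRoot_of_mul hS hR hg hv₂
  have hg₀ : IsMeixnerRoot (2 * b - b₂) (2 * d - d₂) 0 g := by
    simp only [IsMeixnerRoot, map_sub, map_mul, map_ofNat] at hg hg₂ ⊢
    linear_combination 2 * hg - hg₂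
  refine ⟨g, hR, ?_, hg₀⟩
  rw [show b₂ - b = b - (2 * b - b₂) by ring, show d₂ - d = d - (2 * d - d₂) by ring]
  exact hg₀.eq_X_mul hg

theorem IsAffineMeixnerPair.eq_add_mul {a' v' b' d' : k}
    (h : IsAffineMeixnerPair a v β γ p σ R S) (hv' : v' ≠ 0)
    (ht : IsMeixnerPair a' v' b' d' (C t * R) (C t * S)) : d' = γ + t * σ := by
  obtain ⟨g, hR, rfl, hg⟩ := h
  have hgS : IsMeixnerRoot (β + p) (γ + σ) (X * (C p + C σ * g)) g := by
    rw [isMeixnerRoot_zero_iff] at hg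
    simp only [IsMeixnerRoot, map_add]
    linear_combination hg
  have hgt := ht.isMeixnerRoot_of_mul (by simp) hR hgS hv'
  have heq : C (t * p) + C (t * σ) * g = C (b' - β) + C (d' - γ) * g := by
    apply mul_left_cancel₀ (X_ne_zero (R := k))
    rw [← hg.eq_X_mul hgt, map_mul, map_mul]
    ring
  have hg₀ := hg.constantCoeff_eq_zero (map_zero _)
  have hg₁ := hg.coeff_one_eq_one (map_zero _)
  rw [(coeffs_eq_of_C_add_C_mul_eq hg₀ hg₁ hg₀ hg₁ heq).2, add_sub_cancel]

end Domain

theorem IsAffineMeixnerPair.eq_affine {k : Type*} [Field k] {a v β γ p σ : k} {R S : k⟦X⟧}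
    (h : IsAffineMeixnerPair a v β γ p σ R S) (hv : v ≠ 0) :
    S = C (σ / v) * R + C (p - σ / v * a) * X := by
  obtain ⟨g, rfl, rfl, -⟩ := h
  have hσ : C σ = C (σ / v) * C v := by rw [← map_mul, div_mul_cancel₀ _ hv]
  simp only [hσ, map_sub, map_mul]
  ring

end MeixnerRoot

theorem nonneg_of_forall_pos_nonneg_add_mul {x y : ℝ} (h : ∀ t > 0, 0 ≤ x + t * y) :
    0 ≤ x ∧ 0 ≤ y := by
  have nonneg_left {x y : ℝ} (h : ∀ t > 0, 0 ≤ x + t * y) : 0 ≤ x := by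
    have hlim : Filter.Tendsto (fun t : ℝ => x + t * y) (nhdsWithin 0 (Set.Ioi 0)) (nhds x) :=
      (Continuous.tendsto' (by fun_prop) 0 x (by simp)).mono_left nhdsWithin_le_nhds
    exact ge_of_tendsto hlim (Filter.eventually_of_mem self_mem_nhdsWithin h)
  refine ⟨nonneg_left h, nonneg_left (y := x) fun t ht => ?_⟩
  have hmul := mul_nonneg ht.le (h t⁻¹ (inv_pos.2 ht))
  rwa [mul_add, mul_inv_cancel_left₀ ht.ne', add_comm] at hmul

theorem IsMeixnerPair.exists_isAffineMeixnerPair {a v b d : ℝ} {R S : ℂ⟦X⟧}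
    (hS : constantCoeff S = 0) (h : IsMeixnerPair (a : ℂ) v b d R S)
    (ht : ∀ t : ℝ, 0 < t → ∃ a' v' b' d' : ℝ, 0 < v' ∧ 0 ≤ d' ∧
      IsMeixnerPair (a' : ℂ) v' b' d' (C (t : ℂ) * R) (C (t : ℂ) * S)) :
    ∃ β γ p σ : ℝ, 0 ≤ γ ∧ 0 ≤ σ ∧ IsAffineMeixnerPair (a : ℂ) v β γ p σ R S := by
  obtain ⟨a₂, v₂, b₂, d₂, hv₂, -, h₂⟩ := ht 2 two_pos
  have hv₂' : (v₂ : ℂ) ≠ 0 := by exact_mod_cast hv₂.ne'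
  have haff : IsAffineMeixnerPair (a : ℂ) v (2 * b - b₂ : ℝ) (2 * d - d₂ : ℝ) (b₂ - b : ℝ)
      (d₂ - d : ℝ) R S := by
    push_cast
    exact h.isAffineMeixnerPair_of_two hS hv₂' (by exact_mod_cast h₂)
  obtain ⟨hγ, hσ⟩ := nonneg_of_forall_pos_nonneg_add_mul fun t htpos => by
    obtain ⟨a', v', b', d', hv', hd', h'⟩ := ht t htpos
    have hd't := haff.eq_add_mul (by exact_mod_cast hv'.ne') h'
    exact hd'.trans_eq (by exact_mod_cast hd't)
  exact ⟨_, _, _, _, hγ, hσ, haff⟩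

/-! ### Functionals with Meixner cumulants -/

/-- `φ` is unital with Boolean cumulant series `a w + v w G(w)`, where `G = w (1 + b G + d G²)`. For
real parameters with `v > 0` and `d ≥ 0` these are the free Meixner distributions of mean `a` and
variance `v`; the normalized ones `μ_{b,c}` have `d = 1 + c`. -/
def HasMeixnerCumulants (a v b d : ℂ) (φ : Functional) : Prop :=
  φ 1 = 1 ∧ IsMeixnerPair a v b d (booleanCumulantSeries φ) 0

theorem hasMeixnerCumulants_Phi_iff {a v b d : ℂ} {ρ ψ : Functional} :
    HasMeixnerCumulants a v b d (Phi ρ ψ) ↔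
      IsMeixnerPair a v b d (freeCumulantSeries ρ) (freeCumulantSeries ψ) := by
  have hU := hasSubst_X_mul (1 + momentSeries ψ)
  have hbij := bijective_subst_X_mul (constantCoeff_one_add_momentSeries_ne_zero ψ)
  rw [HasMeixnerCumulants, IsMeixnerPair, IsMeixnerPair, hbij.surjective.exists,
    and_iff_right (Phi_one ρ ψ)]
  refine exists_congr fun g => and_congr ?_ ?_
  · rw [← hbij.injective.eq_iff (a := freeCumulantSeries ρ), ← booleanCumulantSeries_Phi,
      ← mul_right_inj' (one_add_momentSeries_ne_zero ψ)]
    simp only [subst_mul hU, subst_add hU, subst_X hU, C_subst]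
    rw [mul_left_comm, mul_assoc]
  · rw [IsMeixnerRoot, IsMeixnerRoot, ← hbij.injective.eq_iff (a := (1 + _) * g),
      ← mul_right_inj' (one_add_momentSeries_ne_zero ψ)]
    simp only [subst_mul hU, subst_add hU, subst_pow hU, subst_X hU, C_subst, one_subst,
      freeCumulantSeries_spec, add_zero, one_mul]
    rw [mul_left_comm (1 + momentSeries ψ), mul_assoc X]

theorem hasMeixnerCumulants_iff {a v b d : ℂ} {ρ : Functional} (hρ : ρ 1 = 1) :
    HasMeixnerCumulants a v b d ρ ↔
      IsMeixnerPair a v b d (freeCumulantSeries ρ) (freeCumulantSeries ρ) := by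
  rw [← hasMeixnerCumulants_Phi_iff, Phi_self hρ]

theorem hasMeixnerCumulants_freePow {a v b d : ℂ} {ρ : Functional}
    (h : HasMeixnerCumulants a v b d ρ) (t : ℝ) :
    HasMeixnerCumulants (t * a) (t * v) (b - a + t * a) (d - v + t * v) (freePow ρ t) := by
  rw [hasMeixnerCumulants_iff (freePow_one ρ t), freeCumulantSeries_freePow]
  exact (isMeixnerPair_self_iff.1 ((hasMeixnerCumulants_iff h.1).1 h)).isMeixnerPair_mul _

/-! ### Functionals with prescribed moments -/

section MomentFunctional

variable {R : Type*} [CommRing R]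

/-- The linear functional on `R[x]` whose moments are the coefficients of `D`. -/
noncomputable def momentFunctional (D : R⟦X⟧) : Polynomial R →ₗ[R] R :=
  (Polynomial.basisMonomials R).constr R fun n => coeff n D

theorem momentFunctional_monomial (D : R⟦X⟧) (n : ℕ) (a : R) :
    momentFunctional D (Polynomial.monomial n a) = a * coeff n D := by
  have h := (Polynomial.basisMonomials R).constr_basis R (fun n => coeff n D) n
  rw [Polynomial.coe_basisMonomials] at h
  rw [← mul_one a, ← smul_eq_mul, ← Polynomial.smul_monomial, map_smul, momentFunctional, h,
    smul_eq_mul, smul_eq_mul, mul_one]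

theorem momentFunctional_C_mul (D : R⟦X⟧) (a : R) (p : Polynomial R) :
    momentFunctional D (Polynomial.C a * p) = a * momentFunctional D p := by
  rw [← Polynomial.smul_eq_C_mul, map_smul, smul_eq_mul]

theorem momentFunctional_C_mul_left (a : R) (D : R⟦X⟧)
    (p : Polynomial R) : momentFunctional (C a * D) p = a * momentFunctional D p := by
  induction p using Polynomial.induction_on' with
  | add p q hp hq => rw [map_add, map_add, hp, hq, mul_add]
  | monomial n b => rw [momentFunctional_monomial, momentFunctional_monomial, coeff_C_mul,
      mul_left_comm]

theorem momentFunctional_X_pow_mul (D : R⟦X⟧) (m : ℕ) (p : Polynomial R) :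
    momentFunctional D (Polynomial.X ^ m * p) =
      momentFunctional (mk fun n => coeff (n + m) D) p := by
  induction p using Polynomial.induction_on' with
  | add p q hp hq => rw [mul_add, map_add, map_add, hp, hq]
  | monomial n a =>
    rw [Polynomial.X_pow_mul_monomial, momentFunctional_monomial, momentFunctional_monomial,
      coeff_mk]

theorem momentFunctional_mul (D : R⟦X⟧) (f g : Polynomial R) {n : ℕ}
    (hf : f.natDegree < n) (hg : g.natDegree < n) :
    momentFunctional D (f * g) =
      ∑ i : Fin n, ∑ j : Fin n, f.coeff i * g.coeff j * coeff (i + j) D := by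
  conv_lhs => rw [f.as_sum_range' n hf, g.as_sum_range' n hg]
  simp only [Finset.sum_mul_sum, map_sum, Polynomial.monomial_mul_monomial,
    momentFunctional_monomial, Finset.sum_range]

theorem momentFunctional_congr {D E : R⟦X⟧} {p : Polynomial R}
    (h : ∀ n ≤ p.natDegree, coeff n D = coeff n E) :
    momentFunctional D p = momentFunctional E p := by
  rw [p.as_sum_range' _ p.natDegree.lt_succ_self, map_sum, map_sum]
  refine Finset.sum_congr rfl fun n hn => ?_
  rw [momentFunctional_monomial, momentFunctional_monomial,
    h n (Nat.lt_succ_iff.1 (Finset.mem_range.1 hn))]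

theorem momentFunctional_map {S : Type*} [CommRing S] (f : R →+* S) (D : R⟦X⟧)
    (p : Polynomial R) :
    momentFunctional (D.map f) (p.map f) = f (momentFunctional D p) := by
  induction p using Polynomial.induction_on' with
  | add p q hp hq => simp only [Polynomial.map_add, map_add, hp, hq]
  | monomial n a => simp only [Polynomial.map_monomial, momentFunctional_monomial, coeff_map,
      map_mul]

theorem apply_momentFunctional_map_C (κ : Polynomial R →ₗ[R] R) (E : (Polynomial R)⟦X⟧)
    (p : Polynomial R) :
    κ (momentFunctional E (p.map Polynomial.C)) =
      momentFunctional (mk fun n => κ (coeff n E)) p := by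
  induction p using Polynomial.induction_on' with
  | add p q hp hq => simp only [Polynomial.map_add, map_add, hp, hq]
  | monomial n a =>
    rw [Polynomial.map_monomial, momentFunctional_monomial, momentFunctional_monomial, coeff_mk,
      ← Polynomial.smul_eq_C_mul, map_smul, smul_eq_mul]

theorem momentFunctional_coeff_map_C_mul_mk_X_pow (H D : R⟦X⟧) (n : ℕ) :
    momentFunctional D (coeff n (H.map Polynomial.C * mk (Polynomial.X ^ ·))) =
      coeff n (H * D) := by
  simp only [coeff_mul, coeff_map, coeff_mk, map_sum, Polynomial.C_mul_X_pow_eq_monomial,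
    momentFunctional_monomial]

theorem coeff_succ_map_C_mul_mk_X_pow (H : R⟦X⟧) (n : ℕ) :
    coeff (n + 1) (H.map Polynomial.C * mk (Polynomial.X ^ ·)) =
      Polynomial.X * coeff n (H.map Polynomial.C * mk (Polynomial.X ^ ·)) +
        Polynomial.C (coeff (n + 1) H) := by
  have h : H.map Polynomial.C * mk (Polynomial.X ^ ·) =
      X * (C Polynomial.X * (H.map Polynomial.C * mk (Polynomial.X ^ ·))) +
        H.map Polynomial.C := by
    linear_combination H.map Polynomial.C * mk_pow_eq (Polynomial.X : Polynomial R)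
  conv_lhs => rw [h]
  rw [map_add, coeff_succ_X_mul, coeff_C_mul, coeff_map]

/-- The bilinear form `(f, g) ↦ L(f g)` of the functional `L` with moments `D`. -/
noncomputable def momentForm (D : R⟦X⟧) : Polynomial R →ₗ[R] Polynomial R →ₗ[R] R :=
  (LinearMap.mul R (Polynomial R)).compr₂ (momentFunctional D)

theorem momentForm_apply (D : R⟦X⟧) (f g : Polynomial R) :
    momentForm D f g = momentFunctional D (f * g) := rfl

end MomentFunctional

section SymmetricOperator

variable {R V : Type*} [CommRing R] [AddCommGroup V] [Module R V] {T : Module.End R V} {Ω : V}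

theorem momentFunctional_eq_apply_aeval {ℓ : V →ₗ[R] R} {D : R⟦X⟧}
    (hD : ∀ n, coeff n D = ℓ ((T ^ n) Ω)) (p : Polynomial R) :
    momentFunctional D p = ℓ (Polynomial.aeval T p Ω) := by
  induction p using Polynomial.induction_on' with
  | add p q hp hq => rw [map_add, hp, hq, map_add, LinearMap.add_apply, map_add]
  | monomial n a =>
    rw [momentFunctional_monomial, hD, Polynomial.aeval_monomial, Module.End.mul_apply,
      Module.algebraMap_end_apply, map_smul, smul_eq_mul]

theorem isAdjointPair_aeval {B : V →ₗ[R] V →ₗ[R] R} (hT : B.IsAdjointPair B T T)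
    (p : Polynomial R) : B.IsAdjointPair B (Polynomial.aeval T p) (Polynomial.aeval T p) := by
  have isAdjointPair_pow (n : ℕ) : B.IsAdjointPair B (T ^ n : Module.End R V) (T ^ n : _) := by
    induction n with
    | zero => exact LinearMap.isAdjointPair_one
    | succ n ih =>
      have h := ih.mul hT
      rwa [← pow_succ, ← pow_succ'] at h
  induction p using Polynomial.induction_on' with
  | add p q hp hq => rw [map_add]; exact hp.add hq
  | monomial n a =>
    rw [Polynomial.aeval_monomial, ← Algebra.smul_def]
    exact (isAdjointPair_pow n).smul a

theorem momentFunctional_mul_self {B : V →ₗ[R] V →ₗ[R] R} (hT : B.IsAdjointPair B T T)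
    {D : R⟦X⟧} (hD : ∀ n, coeff n D = B Ω ((T ^ n) Ω)) (q : Polynomial R) :
    momentFunctional D (q * q) = B (Polynomial.aeval T q Ω) (Polynomial.aeval T q Ω) := by
  rw [momentFunctional_eq_apply_aeval hD, map_mul, Module.End.mul_apply,
    isAdjointPair_aeval hT]

theorem pow_apply_eq_of_succ {v : ℕ → V} (h0 : v 0 = Ω) (hsucc : ∀ n, v (n + 1) = T (v n))
    (n : ℕ) : (T ^ n) Ω = v n := by
  induction n with
  | zero => rw [pow_zero, Module.End.one_apply, h0]
  | succ n ih => rw [pow_succ', Module.End.mul_apply, ih, hsucc]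

end SymmetricOperator

theorem exists_momentFunctional_mul_self_eq {R : Type*} [CommRing R] {D E : R⟦X⟧} {x : R}
    (hE : E = D + C x * (X * (D * E))) (q : Polynomial R) :
    ∃ f, momentFunctional E (q * q) = momentFunctional D (f * f) := by
  -- The model: multiplication by the variable plus `x` times the projection onto the constants.
  obtain ⟨T, hT⟩ : ∃ T : Module.End R (Polynomial R), ∀ f,
      T f = Polynomial.X * f + Polynomial.C (x * momentFunctional D f) :=
    ⟨LinearMap.mulLeft R Polynomial.X + (x • momentFunctional D).smulRight (1 : Polynomial R),
      fun f => by simp [Polynomial.smul_eq_C_mul]⟩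
  have hsymm : (momentForm D).IsAdjointPair (momentForm D) T T := fun f g => by
    rw [momentForm_apply, momentForm_apply, hT, hT, add_mul, mul_add, map_add, map_add,
      momentFunctional_C_mul, mul_comm f (Polynomial.C _), momentFunctional_C_mul,
      mul_left_comm f, mul_assoc, mul_right_comm x]
  obtain ⟨H, hH⟩ : ∃ H : R⟦X⟧, H = 1 + C x * (X * E) := ⟨_, rfl⟩
  have hHD : H * D = E := by linear_combination D * hH - hE
  have hH_succ (n : ℕ) : coeff (n + 1) H = x * coeff n E := by
    rw [hH, map_add, coeff_C_mul, coeff_succ_X_mul, coeff_one, if_neg n.succ_ne_zero, zero_add]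
  have hpow (n : ℕ) : (T ^ n) 1 = coeff n (H.map Polynomial.C * mk (Polynomial.X ^ ·)) := by
    refine pow_apply_eq_of_succ
      (v := fun n => coeff n (H.map Polynomial.C * mk (Polynomial.X ^ ·)))
      (by simp [hH]) (fun n => ?_) n
    rw [hT, momentFunctional_coeff_map_C_mul_mk_X_pow, hHD, coeff_succ_map_C_mul_mk_X_pow, hH_succ]
  have hE' (n : ℕ) : coeff n E = momentForm D 1 ((T ^ n) 1) := by
    rw [hpow, momentForm_apply, one_mul, momentFunctional_coeff_map_C_mul_mk_X_pow, hHD]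
  exact ⟨_, momentFunctional_mul_self hsymm hE' q⟩

/-! ### Positive definite moment series -/

/-- The coefficients of `D` are the moments of a positive definite functional on `ℝ[x]`. -/
def IsPosDef (D : ℝ⟦X⟧) : Prop := ∀ q : Polynomial ℝ, 0 ≤ momentFunctional D (q * q)

theorem isPosDef_one : IsPosDef 1 := by
  have momentFunctional_one (p : Polynomial ℝ) : momentFunctional 1 p = p.coeff 0 := by
    induction p using Polynomial.induction_on' with
    | add p q hp hq => rw [map_add, hp, hq, Polynomial.coeff_add]
    | monomial n a =>
      rw [momentFunctional_monomial, coeff_one, mul_ite, mul_one, mul_zero,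
        Polynomial.coeff_monomial]
  intro q
  rw [momentFunctional_one, Polynomial.mul_coeff_zero]
  exact mul_self_nonneg _

theorem IsPosDef.C_mul {D : ℝ⟦X⟧} (hD : IsPosDef D) {a : ℝ} (ha : 0 ≤ a) :
    IsPosDef (C a * D) := fun q => by
  rw [momentFunctional_C_mul_left]
  exact mul_nonneg ha (hD q)

/-- Model: `T (a, f) = (α a + L_Θ f, a + x f)` on `ℝ ⊕ ℝ[x]`. -/
theorem IsPosDef.one_add_mul {Θ D : ℝ⟦X⟧} (hΘ : IsPosDef Θ) (α : ℝ)
    (hD : D = 1 + (C α * X + X ^ 2 * Θ) * D) : IsPosDef D := by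
  let B : (ℝ × Polynomial ℝ) →ₗ[ℝ] (ℝ × Polynomial ℝ) →ₗ[ℝ] ℝ :=
    (LinearMap.mul ℝ ℝ).compl₁₂ (LinearMap.fst ℝ ℝ _) (LinearMap.fst ℝ ℝ _) +
      (momentForm Θ).compl₁₂ (LinearMap.snd ℝ ℝ _) (LinearMap.snd ℝ ℝ _)
  have hB (v w) : B v w = v.1 * w.1 + momentFunctional Θ (v.2 * w.2) := rfl
  obtain ⟨T, hT⟩ : ∃ T : Module.End ℝ (ℝ × Polynomial ℝ), ∀ v,
      T v = (α * v.1 + momentFunctional Θ v.2, Polynomial.C v.1 + Polynomial.X * v.2) :=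
    ⟨LinearMap.prod
      (α • LinearMap.fst ℝ ℝ _ + momentFunctional Θ ∘ₗ LinearMap.snd ℝ ℝ _)
      (Polynomial.CAlgHom.toLinearMap ∘ₗ LinearMap.fst ℝ ℝ _ +
        LinearMap.mulLeft ℝ Polynomial.X ∘ₗ LinearMap.snd ℝ ℝ _), fun v => rfl⟩
  have hsymm : B.IsAdjointPair B T T := fun v w => by
    simp only [hB, hT, add_mul, mul_add, map_add, momentFunctional_C_mul,
      mul_comm v.2 (Polynomial.C _), mul_left_comm v.2, mul_assoc Polynomial.X]
    ring
  have hpow (n : ℕ) : (T ^ n) (1, 0) =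
      (coeff n D, coeff n ((X * D).map Polynomial.C * mk (Polynomial.X ^ ·))) := by
    refine pow_apply_eq_of_succ (T := T) (v := fun n =>
      (coeff n D, coeff n ((X * D).map Polynomial.C * mk (Polynomial.X ^ ·)))) ?_ (fun n => ?_) n
    · rw [hD]
      simp
    · have hD' : D = 1 + X * (C α * D + X * D * Θ) := by linear_combination hD
      rw [hT, momentFunctional_coeff_map_C_mul_mk_X_pow, coeff_succ_map_C_mul_mk_X_pow,
        coeff_succ_X_mul, add_comm (Polynomial.C _), Prod.mk.injEq]
      refine ⟨?_, rfl⟩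
      conv_lhs => rw [hD']
      rw [map_add, coeff_succ_X_mul, map_add, coeff_C_mul, coeff_one, if_neg n.succ_ne_zero,
        zero_add]
  have hD' (n : ℕ) : coeff n D = B (1, 0) ((T ^ n) (1, 0)) := by
    rw [hpow, hB, one_mul, zero_mul, map_zero, add_zero]
  intro q
  rw [momentFunctional_mul_self hsymm hD', hB]
  exact add_nonneg (mul_self_nonneg _) (hΘ _)

theorem IsPosDef.posSemidef_hankel {D : ℝ⟦X⟧} (hD : IsPosDef D) (n : ℕ) :
    (Matrix.of fun i j : Fin n => coeff (i + j) D).PosSemidef := by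
  refine .of_dotProduct_mulVec_nonneg (Matrix.IsHermitian.ext fun i j => ?_) fun x => ?_
  · simp [add_comm]
  · have h := hD (∑ i : Fin n, Polynomial.monomial i (x i))
    rw [Finset.sum_mul_sum] at h
    simp only [map_sum, Polynomial.monomial_mul_monomial, momentFunctional_monomial] at h
    refine h.trans_eq (Finset.sum_congr rfl fun i _ => ?_)
    rw [Matrix.mulVec, dotProduct, Finset.mul_sum]
    exact Finset.sum_congr rfl fun j _ => by simp [mul_comm (x j), mul_assoc]

/-- Schur's argument: the Hankel matrix of `D` is a sum of rank one squares `v vᵀ`. -/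
theorem IsPosDef.momentFunctional_momentFunctional_nonneg {K D : ℝ⟦X⟧} (hK : IsPosDef K)
    (hD : IsPosDef D) (f : Polynomial (Polynomial ℝ)) :
    0 ≤ momentFunctional K (momentFunctional (D.map Polynomial.C) (f * f)) := by
  obtain ⟨m, v, hv⟩ :=
    Matrix.posSemidef_iff_eq_sum_vecMulVec.1 (hD.posSemidef_hankel (f.natDegree + 1))
  have hcoeff (i j : Fin (f.natDegree + 1)) : coeff (i + j) D = ∑ k, v k i * v k j := by
    have h := congrFun₂ hv i j
    simpa [Matrix.sum_apply, Matrix.vecMulVec_apply] using h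
  have hsq : momentFunctional (D.map Polynomial.C) (f * f) =
      ∑ k, (∑ i : Fin (f.natDegree + 1), Polynomial.C (v k i) * f.coeff i) *
        ∑ i : Fin (f.natDegree + 1), Polynomial.C (v k i) * f.coeff i := by
    rw [momentFunctional_mul _ f f f.natDegree.lt_succ_self f.natDegree.lt_succ_self]
    simp only [coeff_map, hcoeff, map_sum, map_mul, Finset.sum_mul_sum]
    rw [Finset.sum_comm]
    simp only [Finset.sum_comm (s := (Finset.univ : Finset (Fin m))), Finset.mul_sum]
    refine Finset.sum_congr rfl fun i _ => Finset.sum_congr rfl fun j _ =>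
      Finset.sum_congr rfl fun k _ => by ring
  rw [hsq, map_sum]
  exact Finset.sum_nonneg fun k _ => hK _

theorem IsPosDef.mul_subst {K D : ℝ⟦X⟧} (hK : IsPosDef K) (hD : IsPosDef D) :
    IsPosDef (D * K.subst (X * D)) := by
  let D' : (Polynomial ℝ)⟦X⟧ := D.map Polynomial.C
  let E : (Polynomial ℝ)⟦X⟧ := D' * (mk (Polynomial.X ^ ·) : (Polynomial ℝ)⟦X⟧).subst (X * D')
  have hE : E = D' + C Polynomial.X * (X * (D' * E)) := by
    have h := congrArg (fun Y : (Polynomial ℝ)⟦X⟧ => Y.subst (X * D')) (mk_pow_eq Polynomial.X)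
    have hs := hasSubst_X_mul D'
    simp only [subst_add hs, subst_mul hs, subst_X hs, C_subst, one_subst] at h
    linear_combination D' * h
  have hmix : D * K.subst (X * D) = mk fun n => momentFunctional K (coeff n E) := by
    ext n
    rw [coeff_mk, coeff_mul_subst (by simp), coeff_mul_subst (by simp), map_sum]
    refine Finset.sum_congr rfl fun k _ => ?_
    have h : D' * (X * D') ^ k = (D * (X * D) ^ k).map Polynomial.C := by simp [D']
    rw [h, coeff_map, coeff_mk, mul_comm (Polynomial.X ^ k), Polynomial.C_mul_X_pow_eq_monomial,
      momentFunctional_monomial, mul_comm]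
  intro q
  rw [hmix, ← apply_momentFunctional_map_C, Polynomial.map_mul]
  obtain ⟨f, hf⟩ := exists_momentFunctional_mul_self_eq hE (q.map Polynomial.C)
  rw [hf]
  exact hK.momentFunctional_momentFunctional_nonneg hD f

theorem X_pow_dvd_sub_of_eq_one_add_mul {R : Type*} [CommRing R] {P Q D E : R⟦X⟧} {n : ℕ}
    (hD : D = 1 + P * D) (hE : E = 1 + Q * E) (h : X ^ n ∣ P - Q) : X ^ n ∣ D - E := by
  have hDE : D - E = D * E * (P - Q) := by linear_combination E * hD - D * hE
  exact hDE ▸ h.mul_left _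

theorem exists_isPosDef_X_pow_dvd_map_sub {K : ℝ⟦X⟧} (hK : IsPosDef K) {α : ℝ} {S : ℂ⟦X⟧}
    (hS : S = 1 + (C (α : ℂ) * X +
      X ^ 2 * (S * (K.map Complex.ofRealHom).subst (X * S))) * S) (n : ℕ) :
    ∃ D : ℝ⟦X⟧, IsPosDef D ∧ X ^ n ∣ D.map Complex.ofRealHom - S := by
  induction n with
  | zero => exact ⟨1, isPosDef_one, by simp⟩
  | succ n ih =>
    obtain ⟨D, hD, hDS⟩ := ih
    let P := C α * X + X ^ 2 * (D * K.subst (X * D))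
    have hinv : (1 - P)⁻¹ = 1 + P * (1 - P)⁻¹ := by
      linear_combination PowerSeries.mul_inv_cancel (1 - P) (by simp [P])
    refine ⟨(1 - P)⁻¹, (hK.mul_subst hD).one_add_mul α hinv, ?_⟩
    have hmap := congrArg (PowerSeries.map Complex.ofRealHom) hinv
    rw [map_add, map_one, map_mul] at hmap
    refine X_pow_dvd_sub_of_eq_one_add_mul hmap hS ?_
    obtain ⟨Q, hQ⟩ := X_pow_dvd_mul_subst_sub_mul_subst hDS (K.map Complex.ofRealHom)
    refine ⟨X * Q, ?_⟩
    have hsubst : PowerSeries.map Complex.ofRealHom (K.subst (X * D)) =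
        (K.map Complex.ofRealHom).subst (X * D.map Complex.ofRealHom) := by
      rw [← map_X Complex.ofRealHom, ← map_mul]
      exact map_subst (hasSubst_X_mul D) K
    simp only [P, map_add, map_mul, map_pow, map_X, map_C, hsubst]
    rw [Complex.ofRealHom_eq_coe]
    linear_combination X ^ 2 * hQ

theorem exists_isPosDef_eq_map {S : ℂ⟦X⟧}
    (h : ∀ n, ∃ D : ℝ⟦X⟧, IsPosDef D ∧ X ^ n ∣ D.map Complex.ofRealHom - S) :
    ∃ D : ℝ⟦X⟧, IsPosDef D ∧ S = D.map Complex.ofRealHom := by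
  choose D hD hDS using h
  have coeff_eq {m n : ℕ} (hmn : m < n) : coeff m S = ((coeff m (D n) : ℝ) : ℂ) := by
    have h := X_pow_dvd_iff.1 (hDS n) m hmn
    rw [map_sub, coeff_map, sub_eq_zero] at h
    exact h.symm
  refine ⟨mk fun n => coeff n (D (n + 1)), fun q => ?_, PowerSeries.ext fun n => ?_⟩
  · rw [momentFunctional_congr (E := D ((q * q).natDegree + 1)) fun n hn => ?_]
    · exact hD _ q
    · rw [coeff_mk]
      exact_mod_cast (coeff_eq n.lt_succ_self).symm.trans (coeff_eq (Nat.lt_succ_iff.2 hn))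
  · rw [coeff_map, coeff_mk]
    exact coeff_eq n.lt_succ_self

/-! ### States -/

theorem exists_eq_map_add_C_I_mul_map (p : Polynomial ℂ) : ∃ q r : Polynomial ℝ,
    p = q.map Complex.ofRealHom + Polynomial.C Complex.I * r.map Complex.ofRealHom := by
  induction p using Polynomial.induction_on' with
  | add p p' hp hp' =>
    obtain ⟨q, r, rfl⟩ := hp
    obtain ⟨q', r', rfl⟩ := hp'
    refine ⟨q + q', r + r', ?_⟩
    rw [Polynomial.map_add, Polynomial.map_add]
    ring
  | monomial n z =>
    refine ⟨Polynomial.monomial n z.re, Polynomial.monomial n z.im, ?_⟩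
    rw [Polynomial.map_monomial, Polynomial.map_monomial, Polynomial.C_mul_monomial, ← map_add,
      mul_comm Complex.I]
    exact congrArg _ (Complex.re_add_im z).symm

theorem map_star_mul_self (q r : Polynomial ℝ) :
    (q.map Complex.ofRealHom + Polynomial.C Complex.I * r.map Complex.ofRealHom).map
        (starRingEnd ℂ) *
      (q.map Complex.ofRealHom + Polynomial.C Complex.I * r.map Complex.ofRealHom) =
        (q * q + r * r).map Complex.ofRealHom := by
  have map_conj (p : Polynomial ℝ) :
      (p.map Complex.ofRealHom).map (starRingEnd ℂ) = p.map Complex.ofRealHom := by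
    ext n
    simp
  have hI : (Polynomial.C Complex.I : Polynomial ℂ) ^ 2 = -1 := by
    rw [← map_pow, Complex.I_sq, map_neg, map_one]
  simp only [Polynomial.map_add, Polynomial.map_mul, map_conj, Polynomial.map_C, Complex.conj_I,
    map_neg]
  linear_combination (-(r.map Complex.ofRealHom) ^ 2) * hI

theorem eq_momentFunctional {φ : Functional} (hφ : φ 1 = 1) :
    φ = momentFunctional (1 + momentSeries φ) := by
  refine (Polynomial.basisMonomials ℂ).ext fun n => ?_
  rw [Polynomial.coe_basisMonomials, momentFunctional_monomial, one_add_momentSeries_eq_mk hφ,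
    coeff_mk, one_mul, ← Polynomial.monomial_one_right_eq_X_pow]

theorem isState_of_isPosDef {φ : Functional} (hφ : φ 1 = 1) {D : ℝ⟦X⟧} (hD : IsPosDef D)
    (h : 1 + momentSeries φ = D.map Complex.ofRealHom) : IsState φ := by
  have hφD : φ = momentFunctional (D.map Complex.ofRealHom) := h ▸ eq_momentFunctional hφ
  refine ⟨hφ, fun p => ?_, fun p => ?_⟩
  · have hconj : D.map Complex.ofRealHom =
        (D.map Complex.ofRealHom).map (starRingEnd ℂ) := by
      ext n
      simp
    conv_lhs => rw [hφD, hconj, momentFunctional_map, ← hφD]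
  · obtain ⟨q, r, rfl⟩ := exists_eq_map_add_C_I_mul_map p
    rw [map_star_mul_self, hφD, momentFunctional_map, Complex.ofRealHom_eq_coe, Complex.ofReal_re,
      map_add]
    exact add_nonneg (hD q) (hD r)

theorem isState_of_freeCumulantSeries {φ : Functional} (hφ : φ 1 = 1) {α : ℝ} {K : ℝ⟦X⟧}
    (hK : IsPosDef K)
    (hR : freeCumulantSeries φ = C (α : ℂ) * X + X ^ 2 * K.map Complex.ofRealHom) :
    IsState φ := by
  have hS : 1 + momentSeries φ = 1 + (C (α : ℂ) * X + X ^ 2 * ((1 + momentSeries φ) *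
      (K.map Complex.ofRealHom).subst (X * (1 + momentSeries φ)))) * (1 + momentSeries φ) := by
    have h := freeCumulantSeries_spec φ
    have hU := hasSubst_X_mul (1 + momentSeries φ)
    simp only [hR, subst_add hU, subst_mul hU, subst_pow hU, subst_X hU, C_subst] at h
    linear_combination -h
  obtain ⟨D, hD, hφD⟩ := exists_isPosDef_eq_map (exists_isPosDef_X_pow_dvd_map_sub hK hS)
  exact isState_of_isPosDef hφ hD hφD

theorem isFreelyInfinitelyDivisible_of_freeCumulantSeries {φ : Functional} (hφ : φ 1 = 1) {α : ℝ}
    {K : ℝ⟦X⟧} (hK : IsPosDef K)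
    (hR : freeCumulantSeries φ = C (α : ℂ) * X + X ^ 2 * K.map Complex.ofRealHom) :
    IsFreelyInfinitelyDivisible φ := by
  refine ⟨isState_of_freeCumulantSeries hφ hK hR, fun t ht =>
    isState_of_freeCumulantSeries (freePow_one φ t) (hK.C_mul ht) (α := t * α) ?_⟩
  rw [freeCumulantSeries_freePow, hR, map_mul, map_C, Complex.ofRealHom_eq_coe, Complex.ofReal_mul,
    map_mul]
  ring

/-! ### Jacobi parameters -/

section Jacobi

variable {φ ψ : Functional} {β γ : ℕ → ℝ}

theorem apply_C_mul (φ : Functional) (z : ℂ) (p : Polynomial ℂ) :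
    φ (Polynomial.C z * p) = z * φ p := by
  rw [← Polynomial.smul_eq_C_mul, map_smul, smul_eq_mul]

theorem X_mul_jacobiPolynomial_zero (β γ : ℕ → ℝ) :
    Polynomial.X * jacobiPolynomial β γ 0 =
      jacobiPolynomial β γ 1 + Polynomial.C (β 0 : ℂ) * jacobiPolynomial β γ 0 := by
  simp [jacobiPolynomial]

theorem X_mul_jacobiPolynomial_succ (β γ : ℕ → ℝ) (n : ℕ) :
    Polynomial.X * jacobiPolynomial β γ (n + 1) =
      jacobiPolynomial β γ (n + 2) +
        Polynomial.C (β (n + 1) : ℂ) * jacobiPolynomial β γ (n + 1) +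
        Polynomial.C (γ (n + 1) : ℂ) * jacobiPolynomial β γ n := by
  rw [jacobiPolynomial]
  ring

theorem apply_X_pow_succ_mul_jacobiPolynomial_zero (φ : Functional) (β γ : ℕ → ℝ) (k : ℕ) :
    φ (Polynomial.X ^ (k + 1) * jacobiPolynomial β γ 0) =
      φ (Polynomial.X ^ k * jacobiPolynomial β γ 1) +
        β 0 * φ (Polynomial.X ^ k * jacobiPolynomial β γ 0) := by
  rw [pow_succ, mul_assoc, X_mul_jacobiPolynomial_zero, mul_add, map_add, mul_left_comm,
    apply_C_mul]

theorem apply_X_pow_succ_mul_jacobiPolynomial_succ (φ : Functional) (β γ : ℕ → ℝ) (k n : ℕ) :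
    φ (Polynomial.X ^ (k + 1) * jacobiPolynomial β γ (n + 1)) =
      φ (Polynomial.X ^ k * jacobiPolynomial β γ (n + 2)) +
        β (n + 1) * φ (Polynomial.X ^ k * jacobiPolynomial β γ (n + 1)) +
        γ (n + 1) * φ (Polynomial.X ^ k * jacobiPolynomial β γ n) := by
  rw [pow_succ, mul_assoc, X_mul_jacobiPolynomial_succ, mul_add, mul_add, map_add, map_add,
    mul_left_comm, apply_C_mul, mul_left_comm _ (Polynomial.C _), apply_C_mul]

theorem apply_X_pow_mul_jacobiPolynomial_eq_zero {k n : ℕ}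
    (h : ∀ m, n ≤ m + k → φ (jacobiPolynomial β γ m) = 0) :
    φ (Polynomial.X ^ k * jacobiPolynomial β γ n) = 0 := by
  induction k generalizing n with
  | zero => simpa using h n le_rfl
  | succ k ih =>
    cases n with
    | zero =>
      rw [apply_X_pow_succ_mul_jacobiPolynomial_zero, ih fun m _ => h m (by omega),
        ih fun m _ => h m (by omega), mul_zero, add_zero]
    | succ n =>
      rw [apply_X_pow_succ_mul_jacobiPolynomial_succ, ih fun m _ => h m (by omega),
        ih fun m _ => h m (by omega), ih fun m _ => h m (by omega), mul_zero, mul_zero, add_zero,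
        add_zero]

theorem HasJacobiParameters.apply_succ (h : HasJacobiParameters φ β γ) (n : ℕ) :
    φ (jacobiPolynomial β γ (n + 1)) = 0 := by
  simpa [jacobiPolynomial] using h 0 (n + 1) n.succ_ne_zero.symm

theorem apply_mul_jacobiPolynomial_eq_zero (h : ∀ n, φ (jacobiPolynomial β γ (n + 1)) = 0)
    {p : Polynomial ℂ} {n : ℕ} (hp : p.natDegree < n) : φ (p * jacobiPolynomial β γ n) = 0 := by
  rw [p.as_sum_range_C_mul_X_pow, Finset.sum_mul, map_sum]
  refine Finset.sum_eq_zero fun k hk => ?_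
  have hkn : k < n := (Finset.mem_range_succ_iff.1 hk).trans_lt hp
  rw [mul_assoc, apply_C_mul, apply_X_pow_mul_jacobiPolynomial_eq_zero, mul_zero]
  rintro (_ | m) hm
  · omega
  · exact h m

theorem isMonicOfDegree_jacobiPolynomial (β γ : ℕ → ℝ) (n : ℕ) :
    (jacobiPolynomial β γ n).IsMonicOfDegree n := by
  induction n using Nat.twoStepInduction with
  | zero => exact Polynomial.isMonicOfDegree_zero_iff.2 rfl
  | one => exact Polynomial.isMonicOfDegree_X_sub_one _
  | more n ih₀ ih₁ =>
    rw [jacobiPolynomial, show n + 2 = 1 + (n + 1) by omega]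
    refine ((Polynomial.isMonicOfDegree_X_sub_one _).mul ih₁).sub ?_
    exact (Polynomial.natDegree_C_mul_le _ _).trans_lt (by rw [ih₀.natDegree_eq]; omega)

theorem hasJacobiParameters_of_apply_succ_eq_zero
    (h : ∀ n, φ (jacobiPolynomial β γ (n + 1)) = 0) : HasJacobiParameters φ β γ := by
  have apply_mul_eq_zero {m n : ℕ} (hmn : m < n) :
      φ (jacobiPolynomial β γ m * jacobiPolynomial β γ n) = 0 :=
    apply_mul_jacobiPolynomial_eq_zero h
      ((isMonicOfDegree_jacobiPolynomial β γ m).natDegree_eq.trans_lt hmn)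
  intro m n hmn
  rcases hmn.lt_or_gt with hlt | hgt
  · exact apply_mul_eq_zero hlt
  · rw [mul_comm]
    exact apply_mul_eq_zero hgt

theorem HasJacobiParameters.unique (hφ : HasJacobiParameters φ β γ)
    (hψ : HasJacobiParameters ψ β γ) (h : φ 1 = ψ 1) : φ = ψ := by
  have hsub (n : ℕ) : (φ - ψ) (jacobiPolynomial β γ n) = 0 := by
    cases n with
    | zero => simp [jacobiPolynomial, h]
    | succ n => simp [hφ.apply_succ, hψ.apply_succ]
  refine (Polynomial.basisMonomials ℂ).ext fun n => sub_eq_zero.1 ?_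
  simpa [jacobiPolynomial, Polynomial.monomial_one_right_eq_X_pow] using
    apply_X_pow_mul_jacobiPolynomial_eq_zero (k := n) (n := 0) fun m _ => hsub m

/-- The moments of `φ` against `Pₙ` are read off from the remainders `T n` of the continued fraction
expansion of the moment series. -/
theorem apply_X_pow_mul_jacobiPolynomial {T : ℕ → ℂ⟦X⟧} (hφ : φ 1 = 1)
    (hT₀ : 1 + momentSeries φ = T 0) (hT₁ : T 0 = 1 + X * (T 1 + C (β 0 : ℂ) * T 0))
    (hT : ∀ n, T (n + 1) =
      X * (T (n + 2) + C (β (n + 1) : ℂ) * T (n + 1) + C (γ (n + 1) : ℂ) * T n)) (n k : ℕ) :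
    φ (Polynomial.X ^ k * jacobiPolynomial β γ n) = coeff k (T n) := by
  have apply_zero (k : ℕ) : φ (Polynomial.X ^ k * jacobiPolynomial β γ 0) = coeff k (T 0) := by
    rw [← hT₀, one_add_momentSeries_eq_mk hφ, coeff_mk, jacobiPolynomial, mul_one]
  induction n using Nat.twoStepInduction generalizing k with
  | zero => exact apply_zero k
  | one =>
    have hk := congrArg (coeff (k + 1)) hT₁
    rw [map_add, coeff_succ_X_mul, map_add, coeff_C_mul, ← apply_zero, ← apply_zero,
      apply_X_pow_succ_mul_jacobiPolynomial_zero] at hk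
    simpa [coeff_one] using hk
  | more n ih₀ ih₁ =>
    have hk := congrArg (coeff (k + 1)) (hT n)
    rw [coeff_succ_X_mul, map_add, map_add, coeff_C_mul, coeff_C_mul, ← ih₀, ← ih₁, ← ih₁,
      apply_X_pow_succ_mul_jacobiPolynomial_succ] at hk
    simpa using hk

theorem jacobiPolynomial_map_star (β γ : ℕ → ℝ) (n : ℕ) :
    (jacobiPolynomial β γ n).map (starRingEnd ℂ) = jacobiPolynomial β γ n := by
  induction n using Nat.twoStepInduction with
  | zero => simp [jacobiPolynomial]
  | one => simp [jacobiPolynomial]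
  | more n ih₀ ih₁ => simp [jacobiPolynomial, ih₀, ih₁]

theorem HasJacobiParameters.apply_mul_self (h : HasJacobiParameters φ β γ) (n : ℕ) :
    φ (jacobiPolynomial β γ n * jacobiPolynomial β γ n) =
      φ (Polynomial.X ^ n * jacobiPolynomial β γ n) := by
  rcases eq_or_ne n 0 with rfl | hn
  · simp [jacobiPolynomial]
  · rw [← sub_eq_zero, ← map_sub, ← sub_mul]
    exact apply_mul_jacobiPolynomial_eq_zero h.apply_succ
      ((isMonicOfDegree_jacobiPolynomial β γ n).natDegree_sub_X_pow hn)

end Jacobi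

/-! ### Free Meixner distributions -/

theorem HasMeixnerCumulants.exists_apply_X_pow_mul_jacobiPolynomial {a v b d : ℝ} {φ : Functional}
    (h : HasMeixnerCumulants a v b d φ) : ∃ g : ℂ⟦X⟧, IsMeixnerRoot (b : ℂ) d 0 g ∧ ∀ n k,
      φ (Polynomial.X ^ k * jacobiPolynomial (fun n => if n = 0 then a else b)
        (fun n => if n = 1 then v else d) (n + 1)) =
        coeff k (C ((v * d ^ n : ℝ) : ℂ) * (g ^ (n + 1) * (1 + momentSeries φ))) := by
  obtain ⟨hφ, g, hη, hg⟩ := h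
  refine ⟨g, hg, fun n => ?_⟩
  let T : ℕ → ℂ⟦X⟧
    | 0 => 1 + momentSeries φ
    | n + 1 => C ((v * d ^ n : ℝ) : ℂ) * (g ^ (n + 1) * (1 + momentSeries φ))
  rw [booleanCumulantSeries_eq_iff] at hη
  rw [isMeixnerRoot_zero_iff] at hg
  refine apply_X_pow_mul_jacobiPolynomial (T := T) hφ rfl ?_ (fun n => ?_) (n + 1)
  · simp only [T, if_true, pow_zero, mul_one, zero_add, pow_one]
    linear_combination hη
  · cases n with
    | zero =>
      simp only [T, if_true, zero_add, Nat.succ_ne_zero, if_false, pow_zero, pow_one,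
        Complex.ofReal_mul, Complex.ofReal_one, map_mul, map_one]
      linear_combination C (v : ℂ) * (1 + momentSeries φ) * hg
    | succ n =>
      simp only [T, Nat.add_eq_right, Nat.succ_ne_zero, if_false, Complex.ofReal_mul,
        Complex.ofReal_pow, map_mul, map_pow]
      linear_combination C (v : ℂ) * C (d : ℂ) ^ (n + 1) * g ^ (n + 1) * (1 + momentSeries φ) * hg

theorem HasMeixnerCumulants.hasJacobiParameters {a v b d : ℝ} {φ : Functional}
    (h : HasMeixnerCumulants a v b d φ) :
    HasJacobiParameters φ (fun n => if n = 0 then a else b) (fun n => if n = 1 then v else d) := by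
  obtain ⟨g, hg, hφg⟩ := h.exists_apply_X_pow_mul_jacobiPolynomial
  refine hasJacobiParameters_of_apply_succ_eq_zero fun n => ?_
  have hg₀ := hg.constantCoeff_eq_zero (map_zero _)
  simpa [hg₀] using hφg n 0

theorem HasMeixnerCumulants.nonneg_of_isState {a v b d : ℝ} {φ : Functional}
    (h : HasMeixnerCumulants a v b d φ) (hφ : IsState φ) (hv : 0 < v) : 0 ≤ d := by
  obtain ⟨g, hg, hφg⟩ := h.exists_apply_X_pow_mul_jacobiPolynomial
  have hnonneg := hφ.nonneg (jacobiPolynomial (fun n => if n = 0 then a else b)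
    (fun n => if n = 1 then v else d) 2)
  rw [jacobiPolynomial_map_star, h.hasJacobiParameters.apply_mul_self, hφg,
    isMeixnerRoot_zero_iff.1 hg] at hnonneg
  have hcoeff : coeff 2 (X ^ 2 * ((1 + C (b : ℂ) * g + C (d : ℂ) * g ^ 2) ^ 2 *
      (1 + momentSeries φ))) = 1 := by
    rw [← zero_add 2, coeff_X_pow_mul]
    simp [hg.constantCoeff_eq_zero (map_zero _), constantCoeff_momentSeries]
  rw [mul_pow, mul_assoc, coeff_C_mul, hcoeff, mul_one, Complex.ofReal_re, pow_one] at hnonneg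
  exact nonneg_of_mul_nonneg_right hnonneg hv

theorem IsMeixnerRoot.exists_isPosDef {b d : ℝ} {g : ℂ⟦X⟧} (hg : IsMeixnerRoot (b : ℂ) d 0 g)
    (hd : 0 ≤ d) : ∃ E : ℝ⟦X⟧, IsPosDef E ∧ g = X * E.map Complex.ofRealHom := by
  rw [isMeixnerRoot_zero_iff] at hg
  obtain ⟨E, hE, hgE⟩ := exists_isPosDef_eq_map <|
    exists_isPosDef_X_pow_dvd_map_sub (S := 1 + C (b : ℂ) * g + C (d : ℂ) * g ^ 2) (α := b)
      (isPosDef_one.C_mul hd) <| by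
        rw [map_mul, map_one, mul_one, PowerSeries.map_C, C_subst, Complex.ofRealHom_eq_coe]
        linear_combination (C (b : ℂ) +
          C (d : ℂ) * (g + X * (1 + C (b : ℂ) * g + C (d : ℂ) * g ^ 2))) * hg
  exact ⟨E, hE, hgE ▸ hg⟩

theorem HasMeixnerCumulants.exists_isPosDef {a v b d : ℝ} {φ : Functional}
    (h : HasMeixnerCumulants a v b d φ) (hv : 0 ≤ v) (hd : 0 ≤ d) :
    ∃ D : ℝ⟦X⟧, IsPosDef D ∧ 1 + momentSeries φ = D.map Complex.ofRealHom := by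
  obtain ⟨-, g, hη, hg⟩ := h
  obtain ⟨E, hE, rfl⟩ := hg.exists_isPosDef hd
  obtain ⟨D, hD⟩ : ∃ D, (1 - (C a * X + X ^ 2 * (C v * E))) * D = 1 :=
    ⟨_, PowerSeries.mul_inv_cancel _ (by simp)⟩
  refine ⟨D, (hE.C_mul hv).one_add_mul a (by linear_combination hD), ?_⟩
  have hD' := congrArg (PowerSeries.map Complex.ofRealHom) hD
  simp only [map_mul, map_sub, map_add, map_one, map_pow, map_X, PowerSeries.map_C,
    Complex.ofRealHom_eq_coe] at hD'
  rw [booleanCumulantSeries_eq_iff] at hη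
  linear_combination PowerSeries.map Complex.ofRealHom D * hη - (1 + momentSeries φ) * hD'

theorem HasMeixnerCumulants.isState {a v b d : ℝ} {φ : Functional}
    (h : HasMeixnerCumulants a v b d φ) (hv : 0 ≤ v) (hd : 0 ≤ d) : IsState φ := by
  obtain ⟨D, hD, hφD⟩ := h.exists_isPosDef hv hd
  exact isState_of_isPosDef h.1 hD hφD

theorem hasMeixnerCumulants_ofBooleanCumulantSeries {b d : ℂ} {g : ℂ⟦X⟧}
    (hg : IsMeixnerRoot b d 0 g) (a v : ℂ) :
    HasMeixnerCumulants a v b d (ofBooleanCumulantSeries (X * (C a + C v * g))) :=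
  ⟨ofMomentSeries_one _, g, booleanCumulantSeries_ofBooleanCumulantSeries (by simp), hg⟩

theorem exists_hasMeixnerCumulants (a v b d : ℂ) : ∃ φ, HasMeixnerCumulants a v b d φ := by
  obtain ⟨ψ, hψ⟩ : ∃ ψ : Functional, momentSeries ψ =
      (C b * X + C d * X ^ 2).subst (X * (1 + momentSeries ψ)) :=
    ⟨_, ofFreeCumulantSeries_equation (by simp)⟩
  have hU := hasSubst_X_mul (1 + momentSeries ψ)
  simp only [subst_add hU, subst_mul hU, subst_pow hU, subst_X hU, C_subst] at hψ
  refine ⟨_, hasMeixnerCumulants_ofBooleanCumulantSeries (g := X * (1 + momentSeries ψ)) ?_ a v⟩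
  rw [isMeixnerRoot_zero_iff]
  linear_combination X * hψ

theorem isNormalizedFreeMeixner_iff {φ : Functional} :
    IsNormalizedFreeMeixner φ ↔ ∃ b d : ℝ, 0 ≤ d ∧ HasMeixnerCumulants 0 1 b d φ := by
  constructor
  · rintro ⟨b, c, hc, hφ, hJ⟩
    obtain ⟨ψ, hψ⟩ := exists_hasMeixnerCumulants (0 : ℝ) (1 : ℝ) b (1 + c : ℝ)
    obtain rfl := hJ.unique hψ.hasJacobiParameters (hφ.map_one.trans hψ.1.symm)
    exact ⟨b, 1 + c, hc, by simpa using hψ⟩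
  · rintro ⟨b, d, hd, h⟩
    have h' : HasMeixnerCumulants (0 : ℝ) (1 : ℝ) b (1 + (d - 1) : ℝ) φ := by simpa using h
    exact ⟨b, d - 1, by linarith, h'.isState zero_le_one (by linarith), h'.hasJacobiParameters⟩

theorem isFreeMeixner_iff {φ : Functional} :
    IsFreeMeixner φ ↔ ∃ a v b d : ℝ, 0 < v ∧ 0 ≤ d ∧ HasMeixnerCumulants a v b d φ := by
  have booleanCumulantSeries_eq (μ : Functional) (v a : ℝ) :
      booleanCumulantSeries (booleanConv (booleanPow μ v) (dirac a)) =
        C (v : ℂ) * booleanCumulantSeries μ + C (a : ℂ) * X := by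
    rw [booleanCumulantSeries_booleanConv, booleanCumulantSeries_booleanPow,
      booleanCumulantSeries_dirac]
  constructor
  · rintro ⟨μ, v, a, hμ, hv, rfl⟩
    obtain ⟨b, d, hd, -, g, hη, hg⟩ := isNormalizedFreeMeixner_iff.1 hμ
    refine ⟨a, v, b, d, hv, hd, booleanConv_one _ _, g, ?_, hg⟩
    rw [booleanCumulantSeries_eq, hη, map_zero, map_one]
    ring
  · rintro ⟨a, v, b, d, hv, hd, hφ, g, hη, hg⟩
    have hμ := hasMeixnerCumulants_ofBooleanCumulantSeries hg 0 1
    refine ⟨_, v, a, isNormalizedFreeMeixner_iff.2 ⟨b, d, hd, hμ⟩, hv, ?_⟩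
    refine eq_of_booleanCumulantSeries_eq hφ (booleanConv_one _ _) ?_
    rw [booleanCumulantSeries_eq, hη, booleanCumulantSeries_ofBooleanCumulantSeries (by simp),
      map_zero, map_one]
    ring

theorem IsNormalizedFreeMeixner.isFreeMeixner {φ : Functional} (h : IsNormalizedFreeMeixner φ) :
    IsFreeMeixner φ := by
  obtain ⟨b, d, hd, h⟩ := isNormalizedFreeMeixner_iff.1 h
  exact isFreeMeixner_iff.2 ⟨0, 1, b, d, one_pos, hd, by simpa using h⟩

theorem HasMeixnerCumulants.isFreelyInfinitelyDivisible_iff {a v b d : ℝ} {ρ : Functional}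
    (h : HasMeixnerCumulants a v b d ρ) (hv : 0 < v) :
    IsFreelyInfinitelyDivisible ρ ↔ v ≤ d := by
  refine ⟨fun hρ => ?_, fun hvd => ⟨h.isState hv.le (hv.le.trans hvd), fun t ht => ?_⟩⟩
  · refine sub_nonneg.1 (nonneg_of_forall_pos_nonneg_add_mul (y := v) fun t ht => ?_).1
    exact HasMeixnerCumulants.nonneg_of_isState (a := t * a) (b := b - a + t * a) (v := t * v)
      (by exact_mod_cast hasMeixnerCumulants_freePow h t) (hρ.2 t ht.le) (mul_pos ht hv)
  · exact HasMeixnerCumulants.isState (a := t * a) (b := b - a + t * a) (v := t * v)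
      (d := d - v + t * v) (by exact_mod_cast hasMeixnerCumulants_freePow h t) (by positivity)
      (add_nonneg (sub_nonneg.2 hvd) (by positivity))

/-! ### The c-free evolution of free Meixner distributions -/

section Evolution

variable {ρ ψ : Functional} {a v b d β γ p σ s α t : ℝ}

theorem eq_freeConv_freePow_dirac_iff (hψ : ψ 1 = 1) :
    ψ = freeConv (freePow ρ s) (dirac α) ↔
      freeCumulantSeries ψ = C (s : ℂ) * freeCumulantSeries ρ + C (α : ℂ) * X := by
  rw [← freeCumulantSeries_freePow, ← freeCumulantSeries_dirac, ← freeCumulantSeries_freeConv]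
  exact ⟨congrArg freeCumulantSeries, eq_of_freeCumulantSeries_eq hψ (freeConv_one _ _)⟩

theorem IsAffineMeixnerPair.isFreeMeixner_Phi_freePow
    (h : IsAffineMeixnerPair (a : ℂ) v β γ p σ (freeCumulantSeries ρ) (freeCumulantSeries ψ))
    (hv : 0 < v) (hγ : 0 ≤ γ) (hσ : 0 ≤ σ) (ht : 0 < t) :
    IsFreeMeixner (Phi (freePow ρ t) (freePow ψ t)) := by
  refine isFreeMeixner_iff.2 ⟨t * a, t * v, β + t * p, γ + t * σ, mul_pos ht hv,
    add_nonneg hγ (mul_nonneg ht.le hσ), ?_⟩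
  rw [hasMeixnerCumulants_Phi_iff, freeCumulantSeries_freePow, freeCumulantSeries_freePow]
  exact_mod_cast h.isMeixnerPair_mul t

theorem HasMeixnerCumulants.exists_isAffineMeixnerPair (h : HasMeixnerCumulants a v b d (Phi ρ ψ))
    (ht : ∀ t : ℝ, 0 < t → IsFreeMeixner (Phi (freePow ρ t) (freePow ψ t))) :
    ∃ β γ p σ : ℝ, 0 ≤ γ ∧ 0 ≤ σ ∧
      IsAffineMeixnerPair (a : ℂ) v β γ p σ (freeCumulantSeries ρ) (freeCumulantSeries ψ) := by
  refine IsMeixnerPair.exists_isAffineMeixnerPair (constantCoeff_freeCumulantSeries ψ)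
    (hasMeixnerCumulants_Phi_iff.1 h) fun t htpos => ?_
  simpa only [isFreeMeixner_iff, hasMeixnerCumulants_Phi_iff, freeCumulantSeries_freePow] using
    ht t htpos

theorem IsAffineMeixnerPair.exists_eq_freeConv_freePow_dirac
    (h : IsAffineMeixnerPair (a : ℂ) v β γ p σ (freeCumulantSeries ρ) (freeCumulantSeries ψ))
    (hv : 0 < v) (hσ : 0 ≤ σ) (hψ : ψ 1 = 1) :
    ∃ s α : ℝ, -1 ≤ s ∧ ψ = freeConv (freePow ρ (1 + s)) (dirac α) := by
  refine ⟨σ / v - 1, p - σ / v * a, by linarith [div_nonneg hσ hv.le], ?_⟩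
  rw [eq_freeConv_freePow_dirac_iff hψ, add_sub_cancel]
  exact_mod_cast h.eq_affine (by exact_mod_cast hv.ne')

theorem IsAffineMeixnerPair.hasMeixnerCumulants_left
    (h : IsAffineMeixnerPair (a : ℂ) v β γ p σ (freeCumulantSeries ρ) (freeCumulantSeries ψ))
    (hρ : ρ 1 = 1) : HasMeixnerCumulants a v (β + a : ℝ) (γ + v : ℝ) ρ := by
  obtain ⟨g, hR, -, hg⟩ := h
  rw [hasMeixnerCumulants_iff hρ]
  exact_mod_cast IsAffineMeixnerPair.isMeixnerPair ⟨g, hR, hR, hg⟩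

theorem HasMeixnerCumulants.of_forall_isFreeMeixner (h : HasMeixnerCumulants a v b d (Phi ρ ψ))
    (hv : 0 < v) (hρ : ρ 1 = 1) (hψ : ψ 1 = 1)
    (ht : ∀ t : ℝ, 0 < t → IsFreeMeixner (Phi (freePow ρ t) (freePow ψ t))) :
    (∃ b' d' : ℝ, 0 ≤ d' ∧ HasMeixnerCumulants a v b' d' ρ) ∧ IsFreelyInfinitelyDivisible ρ ∧
      ∃ s α : ℝ, -1 ≤ s ∧ ψ = freeConv (freePow ρ (1 + s)) (dirac α) := by
  obtain ⟨β, γ, p, σ, hγ, hσ, haff⟩ := h.exists_isAffineMeixnerPair ht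
  have hM := haff.hasMeixnerCumulants_left hρ
  exact ⟨⟨_, _, add_nonneg hγ hv.le, hM⟩,
    (hM.isFreelyInfinitelyDivisible_iff hv).2 (le_add_of_nonneg_left hγ),
    haff.exists_eq_freeConv_freePow_dirac hv hσ hψ⟩

theorem IsFreeMeixner.isFreeMeixner_Phi_freePow (h : IsFreeMeixner ρ)
    (hρ : IsFreelyInfinitelyDivisible ρ) (hψ : ψ 1 = 1) (hs : -1 ≤ s)
    (hψρ : ψ = freeConv (freePow ρ (1 + s)) (dirac α)) (ht : 0 < t) :
    IsFreeMeixner (Phi (freePow ρ t) (freePow ψ t)) := by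
  obtain ⟨a, v, b, d, hv, -, hM⟩ := isFreeMeixner_iff.1 h
  have haff := (isMeixnerPair_self_iff.1 ((hasMeixnerCumulants_iff hM.1).1 hM)).affine_right
    (s := ((1 + s : ℝ) : ℂ)) (α := α)
  rw [← (eq_freeConv_freePow_dirac_iff hψ).1 hψρ] at haff
  exact IsAffineMeixnerPair.isFreeMeixner_Phi_freePow (a := a) (β := b - a) (γ := d - v)
    (p := (1 + s) * a + α) (σ := (1 + s) * v) (by exact_mod_cast haff) hv
    (sub_nonneg.2 ((hM.isFreelyInfinitelyDivisible_iff hv).1 hρ))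
    (mul_nonneg (by linarith) hv.le) ht

theorem IsFreeMeixner.isFreeMeixner_Phi_freePow_dirac_zero
    (h : IsFreeMeixner (Phi ρ (dirac 0))) (ht : 0 < t) :
    IsFreeMeixner (Phi (freePow ρ t) (freePow (dirac 0) t)) := by
  obtain ⟨a, v, b, d, hv, hd, hM⟩ := isFreeMeixner_iff.1 h
  have hdirac : freeCumulantSeries (dirac 0) = 0 := by
    rw [freeCumulantSeries_dirac, Complex.ofReal_zero, map_zero, zero_mul]
  rw [hasMeixnerCumulants_Phi_iff, hdirac, isMeixnerPair_zero_iff, ← hdirac] at hM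
  exact IsAffineMeixnerPair.isFreeMeixner_Phi_freePow (p := 0) (σ := 0) (by exact_mod_cast hM) hv
    hd le_rfl ht

theorem IsFreeMeixner.isFreeMeixner_Phi_freePow_self (hρ : IsFreelyInfinitelyDivisible ρ)
    (h : IsFreeMeixner (Phi ρ ρ)) (ht : 0 < t) :
    IsFreeMeixner (Phi (freePow ρ t) (freePow ρ t)) := by
  rw [Phi_self hρ.1.map_one] at h
  refine h.isFreeMeixner_Phi_freePow hρ hρ.1.map_one (s := 0) (α := 0) (by norm_num) ?_ ht
  rw [eq_freeConv_freePow_dirac_iff hρ.1.map_one]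
  simp

end Evolution

/-! ### An evolution leaving the free Meixner class -/

theorem IsPosDef.mk_coeff_add_two {D : ℝ⟦X⟧} (hD : IsPosDef D) :
    IsPosDef (mk fun n => coeff (n + 2) D) := fun q => by
  rw [← momentFunctional_X_pow_mul, pow_two, mul_mul_mul_comm]
  exact hD _

/-- `ψ` is the free compound Poisson distribution whose jumps have the moment series `A`. -/
theorem isFreelyInfinitelyDivisible_of_freeCumulantSeries_eq_map_sub_one {ψ : Functional}
    (hψ : ψ 1 = 1) {A : ℝ⟦X⟧} (hA : IsPosDef A) (hA₀ : constantCoeff A = 1)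
    (hR : freeCumulantSeries ψ = A.map Complex.ofRealHom - 1) : IsFreelyInfinitelyDivisible ψ := by
  refine isFreelyInfinitelyDivisible_of_freeCumulantSeries hψ hA.mk_coeff_add_two
    (α := coeff 1 A) ?_
  rw [hR]
  ext n
  rw [map_add, coeff_X_pow_mul']
  rcases n with _ | _ | n
  · simp [constantCoeff_map, hA₀]
  · simp [coeff_one]
  · simp [coeff_one]

/-- The moment series `(1 - 4 z²)^{-1/2}` of the arcsine distribution on `[-2, 2]`. -/
def IsArcsineSeries (A : ℝ⟦X⟧) : Prop :=
  constantCoeff A = 1 ∧ A ^ 2 * (1 - 4 * X ^ 2) = 1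

theorem exists_isArcsineSeries_isPosDef : ∃ A, IsArcsineSeries A ∧ IsPosDef A := by
  obtain ⟨μ, hμ⟩ := exists_hasMeixnerCumulants (0 : ℝ) (2 : ℝ) (0 : ℝ) (1 : ℝ)
  obtain ⟨A, hA, hμA⟩ := hμ.exists_isPosDef zero_le_two zero_le_one
  obtain ⟨-, g, hη, hg⟩ := hμ
  have hA₀ := congrArg constantCoeff hμA
  rw [map_add, constantCoeff_momentSeries, constantCoeff_map] at hA₀
  rw [booleanCumulantSeries_eq_iff, hμA] at hη
  rw [isMeixnerRoot_zero_iff] at hg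
  have hinj := PowerSeries.map_injective Complex.ofRealHom Complex.ofReal_injective
  simp only [Complex.ofReal_zero, map_zero, Complex.ofReal_one, map_one, Complex.ofReal_ofNat,
    map_ofNat] at hη hg
  refine ⟨A, ⟨?_, hinj ?_⟩, hA⟩
  · simpa using hA₀.symm
  · simp only [map_mul, map_pow, map_sub, map_one, map_X, map_ofNat]
    linear_combination (1 + A.map Complex.ofRealHom * (1 - 2 * X * g)) * hη +
      4 * A.map Complex.ofRealHom ^ 2 * X * hg

theorem IsArcsineSeries.map_sub_one_ne {A : ℝ⟦X⟧} (hA : IsArcsineSeries A) (s α : ℂ) :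
    A.map Complex.ofRealHom - 1 ≠ C s * (X ^ 2 * A.map Complex.ofRealHom) + C α * X := by
  intro h
  have hA₂ := congrArg (PowerSeries.map Complex.ofRealHom) hA.2
  simp only [map_mul, map_pow, map_sub, map_one, map_X, map_ofNat] at hA₂
  have hsq : (1 - C s * X ^ 2) ^ 2 = (1 + C α * X) ^ 2 * (1 - 4 * X ^ 2) := by
    linear_combination (-(1 - C s * X ^ 2) ^ 2) * hA₂ + (1 - 4 * X ^ 2) *
      ((1 - C s * X ^ 2) * A.map Complex.ofRealHom + (1 + C α * X)) * h
  have hexpand : 1 - C (2 * s) * X ^ 2 + C (s ^ 2) * X ^ 4 =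
      1 + C (2 * α) * X ^ 1 + C (α ^ 2) * X ^ 2 - C 4 * X ^ 2 - C (8 * α) * X ^ 3 -
        C (4 * α ^ 2) * X ^ 4 := by
    simp only [map_mul, map_pow, map_ofNat]
    linear_combination hsq
  have hcoeff (n : ℕ) := congrArg (coeff n) hexpand
  simp only [map_add, map_sub, coeff_C_mul_X_pow, coeff_one] at hcoeff
  have hα : α = 0 := by simpa using hcoeff 1
  subst hα
  have hs : s = 2 := by
    have h₂ : -(2 * s) = -4 := by simpa using hcoeff 2
    linear_combination -h₂ / 2
  simpa [hs] using hcoeff 4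

theorem exists_not_isFreeMeixner_Phi_freePow : ∃ ρ ψ : Functional,
    IsFreelyInfinitelyDivisible ρ ∧ IsFreelyInfinitelyDivisible ψ ∧
      IsNormalizedFreeMeixner (Phi ρ ψ) ∧
      ∃ t : ℝ, 0 < t ∧ ¬ IsFreeMeixner (Phi (freePow ρ t) (freePow ψ t)) := by
  obtain ⟨A, hAarc, hA⟩ := exists_isArcsineSeries_isPosDef
  obtain ⟨ρ, hρ, hRρ⟩ : ∃ ρ : Functional, ρ 1 = 1 ∧
      freeCumulantSeries ρ = X ^ 2 * A.map Complex.ofRealHom :=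
    ⟨ofFreeCumulantSeries _, ofMomentSeries_one _,
      freeCumulantSeries_ofFreeCumulantSeries (by simp)⟩
  obtain ⟨ψ, hψ, hRψ⟩ : ∃ ψ : Functional, ψ 1 = 1 ∧
      freeCumulantSeries ψ = A.map Complex.ofRealHom - 1 :=
    ⟨ofFreeCumulantSeries _, ofMomentSeries_one _,
      freeCumulantSeries_ofFreeCumulantSeries (by simp [constantCoeff_map, hAarc.1])⟩
  have hφ : HasMeixnerCumulants (0 : ℝ) (1 : ℝ) (0 : ℝ) (4 : ℝ) (Phi ρ ψ) := by
    have hA₂ := congrArg (PowerSeries.map Complex.ofRealHom) hAarc.2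
    simp only [map_mul, map_pow, map_sub, map_one, map_X, map_ofNat] at hA₂
    refine hasMeixnerCumulants_Phi_iff.2 ⟨X * A.map Complex.ofRealHom, ?_, ?_⟩
    · rw [hRρ, Complex.ofReal_zero, map_zero, Complex.ofReal_one, map_one]
      ring
    · rw [IsMeixnerRoot, hRψ, Complex.ofReal_zero, map_zero, Complex.ofReal_ofNat, map_ofNat]
      linear_combination X * hA₂
  refine ⟨ρ, ψ, isFreelyInfinitelyDivisible_of_freeCumulantSeries hρ (α := 0) hA (by simp [hRρ]),
    isFreelyInfinitelyDivisible_of_freeCumulantSeries_eq_map_sub_one hψ hA hAarc.1 hRψ,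
    isNormalizedFreeMeixner_iff.2 ⟨0, 4, zero_le_four, by exact_mod_cast hφ⟩, ?_⟩
  by_contra! hall
  obtain ⟨-, -, s, α, -, hψρ⟩ := hφ.of_forall_isFreeMeixner one_pos hρ hψ hall
  rw [eq_freeConv_freePow_dirac_iff hψ, hRρ, hRψ] at hψρ
  exact hAarc.map_sub_one_ne _ _ hψρ

theorem mainTheorem7_general :
    (∀ ρ ψ : Functional, ρ 1 = 1 → ψ 1 = 1 → IsFreeMeixner (Phi ρ ψ) →
      ((∀ t : ℝ, 0 < t → IsFreeMeixner (Phi (freePow ρ t) (freePow ψ t))) ↔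
        (IsFreeMeixner ρ ∧ IsFreelyInfinitelyDivisible ρ ∧
          ∃ s α : ℝ, -1 ≤ s ∧ ψ = freeConv (freePow ρ (1 + s)) (dirac α)))) ∧
    (∀ ρ ψ : Functional, ρ 1 = 1 → ψ 1 = 1 → IsNormalizedFreeMeixner (Phi ρ ψ) →
      ((∀ t : ℝ, 0 < t → IsFreeMeixner (Phi (freePow ρ t) (freePow ψ t))) ↔
        (IsNormalizedFreeMeixner ρ ∧ IsFreelyInfinitelyDivisible ρ ∧
          ∃ s α : ℝ, -1 ≤ s ∧ ψ = freeConv (freePow ρ (1 + s)) (dirac α)))) ∧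
    (∀ ρ : Functional, IsFreeMeixner (Phi ρ (dirac 0)) →
      ∀ t : ℝ, 0 < t → IsFreeMeixner (Phi (freePow ρ t) (freePow (dirac 0) t))) ∧
    (∀ ρ : Functional, IsFreelyInfinitelyDivisible ρ → IsFreeMeixner (Phi ρ ρ) →
      ∀ t : ℝ, 0 < t → IsFreeMeixner (Phi (freePow ρ t) (freePow ρ t))) ∧
    (∃ ρ ψ : Functional,
      IsFreelyInfinitelyDivisible ρ ∧ IsFreelyInfinitelyDivisible ψ ∧
        IsNormalizedFreeMeixner (Phi ρ ψ) ∧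
        ∃ t : ℝ, 0 < t ∧ ¬ IsFreeMeixner (Phi (freePow ρ t) (freePow ψ t))) := by
  refine ⟨fun ρ ψ hρ hψ h => ⟨fun ht => ?_, ?_⟩, fun ρ ψ hρ hψ h => ⟨fun ht => ?_, ?_⟩,
    fun ρ h t => h.isFreeMeixner_Phi_freePow_dirac_zero,
    fun ρ hρ h t => h.isFreeMeixner_Phi_freePow_self hρ,
    exists_not_isFreeMeixner_Phi_freePow⟩
  · obtain ⟨a, v, b, d, hv, -, hM⟩ := isFreeMeixner_iff.1 h
    obtain ⟨⟨b', d', hd', hMρ⟩, hρψ⟩ := hM.of_forall_isFreeMeixner hv hρ hψ ht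
    exact ⟨isFreeMeixner_iff.2 ⟨a, v, b', d', hv, hd', hMρ⟩, hρψ⟩
  · rintro ⟨hMρ, hFID, s, α, hs, hψρ⟩ t ht
    exact hMρ.isFreeMeixner_Phi_freePow hFID hψ hs hψρ ht
  · obtain ⟨b, d, -, hM⟩ := isNormalizedFreeMeixner_iff.1 h
    obtain ⟨hMρ, hρψ⟩ := HasMeixnerCumulants.of_forall_isFreeMeixner (a := 0) (v := 1)
      (by exact_mod_cast hM) one_pos hρ hψ ht
    exact ⟨isNormalizedFreeMeixner_iff.2 (by simpa using hMρ), hρψ⟩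
  · rintro ⟨hMρ, hFID, s, α, hs, hψρ⟩ t ht
    exact hMρ.isFreeMeixner.isFreeMeixner_Phi_freePow hFID hψ hs hψρ ht

end CFree

open CFree in
theorem mainTheorem7 :
    -- the characterization, for an un-normalized free Meixner `Φ[ρ, ψ]`
    (∀ ρ ψ : Functional,
      IsFreelyInfinitelyDivisible ρ → IsFreelyInfinitelyDivisible ψ → IsFreeMeixner (Phi ρ ψ) →
        ((∀ t : ℝ, 0 < t → IsFreeMeixner (Phi (freePow ρ t) (freePow ψ t))) ↔
          (IsFreeMeixner ρ ∧
            ∃ s α : ℝ, -1 ≤ s ∧ ψ = freeConv (freePow ρ (1 + s)) (dirac α)))) ∧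
    -- the characterization, for a normalized free Meixner `Φ[ρ, ψ]`
    (∀ ρ ψ : Functional,
      IsFreelyInfinitelyDivisible ρ → IsFreelyInfinitelyDivisible ψ →
        IsNormalizedFreeMeixner (Phi ρ ψ) →
        ((∀ t : ℝ, 0 < t → IsFreeMeixner (Phi (freePow ρ t) (freePow ψ t))) ↔
          (IsNormalizedFreeMeixner ρ ∧
            ∃ s α : ℝ, -1 ≤ s ∧ ψ = freeConv (freePow ρ (1 + s)) (dirac α)))) ∧
    -- the Boolean evolution preserves the free Meixner class
    (∀ ρ : Functional, IsFreelyInfinitelyDivisible ρ → IsFreeMeixner (Phi ρ (dirac 0)) →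
      ∀ t : ℝ, 0 < t → IsFreeMeixner (Phi (freePow ρ t) (freePow (dirac 0) t))) ∧
    -- the free evolution preserves the free Meixner class
    (∀ ρ : Functional, IsFreelyInfinitelyDivisible ρ → IsFreeMeixner (Phi ρ ρ) →
      ∀ t : ℝ, 0 < t → IsFreeMeixner (Phi (freePow ρ t) (freePow ρ t))) ∧
    -- the general c-free evolution does not
    (∃ ρ ψ : Functional,
      IsFreelyInfinitelyDivisible ρ ∧ IsFreelyInfinitelyDivisible ψ ∧
        IsNormalizedFreeMeixner (Phi ρ ψ) ∧
        ∃ t : ℝ, 0 < t ∧ ¬ IsFreeMeixner (Phi (freePow ρ t) (freePow ψ t))) := by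
  refine ⟨fun ρ ψ hρ hψ h => ?_, fun ρ ψ hρ hψ h => ?_, fun ρ _ => mainTheorem7_general.2.2.1 ρ,
    mainTheorem7_general.2.2.2⟩
  · simpa [hρ] using mainTheorem7_general.1 ρ ψ hρ.1.map_one hψ.1.map_one h
  · simpa [hρ] using mainTheorem7_general.2.1 ρ ψ hρ.1.map_one hψ.1.map_one h
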